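/- Let $d\ge 1$, and let $H\in C^2(\mathbb R^d\times\mathbb R^d)$ and $G\in C^2(\mathbb R^d)$ be real-valued with uniformly bounded second derivatives, with $p\mapsto H(x,p)$ convex for every $x\in\mathbb R^d$. For $T>0$ consider the Hamilton--Jacobi--Bellman Cauchy problem $$-\partial_t u(t,x)+H(x,\partial_x u(t,x))=0\quad\text{in }(0,T)\times\mathbb R^d,\qquad u(T,x)=G(x)\quad\text{for }x\in\mathbb R^d. \tag{1}$$ For a square matrix $A$ write $\operatorname{Re}A=\tfrac12(A+A^\top)$, and for a symmetric matrix let $\lambda_{\min},\lambda_{\max}$ denote its smallest and largest eigenvalues. Define $$\lambda_0=\inf_{(x,p)}\lambda_{\min}\big(\operatorname{Re}\partial_{xp}H(x,p)\big),\qquad \lambda_H=\sup_{(x,p)}\lambda_{\max}\big(\partial_{xx}H(x,p)\big),\qquad \lambda_G=\inf_{x}\lambda_{\min}\big(D^2G(x)\big),$$ and $\|\partial_{pp}H\|_\infty=\sup_{(x,p)}|\partial_{pp}H(x,p)|$, where $|\cdot|$ is the Euclidean operator norm. Assume that $$\lambda_0^2\ \ge\ \|\partial_{pp}H\|_\infty\,\lambda_H,\qquad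 \lambda_0+\sqrt{\lambda_0^2-\|\partial_{pp}H\|_\infty\,\lambda_H}+\|\partial_{pp}H\|_\infty\,\lambda_G\ \ge\ 0,$$ and that $\lambda_H\le 0$ or $\lambda_0\ge 0$. Then for every $T>0$ problem (1) is well-posed in the class $C^{1,1}_{\rm loc}([0,T]\times\mathbb R^d)$ of functions that are continuously differentiable on $[0,T]\times\mathbb R^d$ (up to $t=0$ and $t=T$) with locally Lipschitz derivative: there is exactly one function $u$ in this class that satisfies (1). -/

import Mathlib

noncomputable section

namespace HJB

/-- The Euclidean space `ℝ^d`. -/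
abbrev Eu (d : ℕ) : Type := EuclideanSpace ℝ (Fin d)

/-- The `i`-th standard basis vector of `ℝ^d`. -/
def basisVec {d : ℕ} (i : Fin d) : Eu d := EuclideanSpace.single i (1 : ℝ)

/-- The second derivative of `f` is uniformly bounded. -/
def BoundedSecondDeriv {F : Type*} [NormedAddCommGroup F] [NormedSpace ℝ F] (f : F → ℝ) : Prop :=
  ∃ C : ℝ, ∀ z, ‖fderiv ℝ (fderiv ℝ f) z‖ ≤ C

/-- The second derivative of `(x, p) ↦ H x p` at `(x, p)`, as a bilinear form on `ℝ^d × ℝ^d`. -/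
def D2 {d : ℕ} (H : Eu d → Eu d → ℝ) (x p : Eu d) : (Eu d × Eu d) →L[ℝ] (Eu d × Eu d) →L[ℝ] ℝ :=
  fderiv ℝ (fderiv ℝ (Function.uncurry H)) (x, p)

/-- The matrix `∂_{xx} H(x,p)`. -/
def dxx {d : ℕ} (H : Eu d → Eu d → ℝ) (x p : Eu d) : Matrix (Fin d) (Fin d) ℝ :=
  Matrix.of fun i j => D2 H x p (basisVec i, 0) (basisVec j, 0)

/-- The matrix `∂_{xp} H(x,p)`, with entries `∂_{x_i} ∂_{p_j} H(x,p)`. -/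
def dxp {d : ℕ} (H : Eu d → Eu d → ℝ) (x p : Eu d) : Matrix (Fin d) (Fin d) ℝ :=
  Matrix.of fun i j => D2 H x p (basisVec i, 0) (0, basisVec j)

/-- The matrix `∂_{pp} H(x,p)`. -/
def dpp {d : ℕ} (H : Eu d → Eu d → ℝ) (x p : Eu d) : Matrix (Fin d) (Fin d) ℝ :=
  Matrix.of fun i j => D2 H x p (0, basisVec i) (0, basisVec j)

/-- The Hessian matrix of `G` at `x`. -/
def hess {d : ℕ} (G : Eu d → ℝ) (x : Eu d) : Matrix (Fin d) (Fin d) ℝ :=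
  Matrix.of fun i j => fderiv ℝ (fderiv ℝ G) x (basisVec i) (basisVec j)

/-- `Re A = (A + Aᵀ) / 2`. -/
def symPart {d : ℕ} (A : Matrix (Fin d) (Fin d) ℝ) : Matrix (Fin d) (Fin d) ℝ :=
  (1 / 2 : ℝ) • (A + A.transpose)

/-- The smallest eigenvalue of a symmetric matrix. -/
def lambdaMin {d : ℕ} (A : Matrix (Fin d) (Fin d) ℝ) : ℝ := sInf (spectrum ℝ A)

/-- The largest eigenvalue of a symmetric matrix. -/
def lambdaMax {d : ℕ} (A : Matrix (Fin d) (Fin d) ℝ) : ℝ := sSup (spectrum ℝ A)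

/-- `λ_0 = inf_{(x,p)} λ_min (Re ∂_{xp} H(x,p))`. -/
def lambdaZero {d : ℕ} (H : Eu d → Eu d → ℝ) : ℝ :=
  ⨅ z : Eu d × Eu d, lambdaMin (symPart (dxp H z.1 z.2))

/-- `λ_H = sup_{(x,p)} λ_max (∂_{xx} H(x,p))`. -/
def lambdaH {d : ℕ} (H : Eu d → Eu d → ℝ) : ℝ :=
  ⨆ z : Eu d × Eu d, lambdaMax (dxx H z.1 z.2)

/-- `λ_G = inf_x λ_min (D²G(x))`. -/
def lambdaG {d : ℕ} (G : Eu d → ℝ) : ℝ :=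
  ⨅ x : Eu d, lambdaMin (hess G x)

/-- `‖∂_{pp} H‖_∞`: the supremum over `(x,p)` of the Euclidean operator norm of `∂_{pp} H(x,p)`. -/
def normDpp {d : ℕ} (H : Eu d → Eu d → ℝ) : ℝ :=
  ⨆ z : Eu d × Eu d, ‖Matrix.toEuclideanCLM (n := Fin d) (𝕜 := ℝ) (dpp H z.1 z.2)‖

/-- The closed space-time strip `[0,T] × ℝ^d`. -/
def strip (d : ℕ) (T : ℝ) : Set (ℝ × Eu d) := Set.Icc 0 T ×ˢ Set.univ

/-- The class `C^{1,1}_loc([0,T] × ℝ^d)`: continuously differentiable up to the boundary of the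
strip, with locally Lipschitz derivative. -/
def IsC11Loc {d : ℕ} (T : ℝ) (u : ℝ × Eu d → ℝ) : Prop :=
  ContDiffOn ℝ 1 u (strip d T) ∧
    LocallyLipschitzOn (strip d T) (fderivWithin ℝ u (strip d T))

/-- `u` is a classical solution in `C^{1,1}_loc([0,T] × ℝ^d)` of
`-∂_t u + H(x, ∂_x u) = 0` in `(0,T) × ℝ^d`, `u(T, ·) = G`. -/
structure IsC11Solution {d : ℕ} (H : Eu d → Eu d → ℝ) (G : Eu d → ℝ) (T : ℝ)
    (u : ℝ × Eu d → ℝ) : Prop where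
  regular : IsC11Loc T u
  equation : ∀ t ∈ Set.Ioo 0 T, ∀ x : Eu d,
    -deriv (fun s => u (s, x)) t + H x (gradient (fun y => u (t, y)) x) = 0
  terminal : ∀ x : Eu d, u (T, x) = G x

/-- The problem on `[0,T]` has one and only one solution in `C^{1,1}_loc([0,T] × ℝ^d)`. -/
def WellPosedC11 {d : ℕ} (H : Eu d → Eu d → ℝ) (G : Eu d → ℝ) (T : ℝ) : Prop :=
  ∃ u : ℝ × Eu d → ℝ, IsC11Solution H G T u ∧
    ∀ v : ℝ × Eu d → ℝ, IsC11Solution H G T v → Set.EqOn v u (strip d T)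

end HJB

end

/-! Reversing time, s = T - t, turns (1) into ∂_s v + H(x, ∂_x v) = 0 with v(0, ·) = G. Its
characteristics X' = ∂_p H, P' = -∂_x H, started at (y, ∇G(y)), exist for all times because the
Hamiltonian field is Lipschitz. The method of characteristics gives a C^{1,1} solution on all of [0,
T] once the maps y ↦ X_s(y) are onto and expanding: c|y - y'| ≤ |X_s(y) - X_s(y')| with c > 0
independent of s.

Expansion comes from a lower barrier k(s) for D²v. Formally D²v solves a matrix Riccati equation
along characteristics, and the bound D²v ≥ k persists when k ≤ 0 and k' ≤ -(λ_H + 2λ_0 k + ‖∂_pp H‖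
k²). If ‖∂_pp H‖ > 0, the hypotheses say that this quadratic has real roots and that its lower root
is nonpositive and at most λ_G; a curve leaving that root downwards is a strict barrier
(`exists_riccati_subsolution`). In integrated form, ⟨ΔP, ΔX⟩ - k|ΔX|² is nondecreasing in s for any
two characteristics (`IsBarrier.monotoneOn`). It starts above ε|Δy|² and is at most a multiple of
|Δy||ΔX|, hence the expansion (`IsBarrier.exists_expansion`). Surjectivity follows by continuation
in s (`surjective_of_expanding_family`).

Neither half differentiates the flow in its initial data or v twice; quadratic Taylor remainders
replace those derivatives. Existence is `exists_solution_of_expansion`. For uniqueness, the gradient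
of any C^{1,1} solution is transported by the flow (`gradient_eq_along_flow`), so its values are
those carried by the characteristics (`exists_eq_characValue`). -/

noncomputable section

namespace HJB

open Set Filter Topology
open scoped NNReal

/-! ### Global flow of a Lipschitz vector field -/

section GlobalFlow

variable {V : Type*} [NormedAddCommGroup V] [NormedSpace ℝ V]

/-- `Φ` is the global flow of the autonomous vector field `F`. -/
structure IsFlow (F : V → V) (Φ : ℝ → V → V) : Prop where
  zero : ∀ z, Φ 0 z = z
  hasDerivAt : ∀ s z, HasDerivAt (fun σ => Φ σ z) (F (Φ s z)) s

open scoped Manifold ContDiff in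
-- Picard–Lindelöf gives an existence time that depends on the Lipschitz constant alone, not on the
-- starting point; local solutions of uniform lifespan extend to the whole line.
theorem exists_isFlow [CompleteSpace V] {F : V → V} {K : ℝ≥0} (hF : LipschitzWith K F)
    (hF1 : ContDiff ℝ 1 F) : ∃ Φ, IsFlow F Φ := by
  have hloc : ∀ z : V, ∃ γ : ℝ → V, γ 0 = z ∧
      IsMIntegralCurveOn (I := 𝓘(ℝ, V)) γ F (Ioo (-(1 / ((K : ℝ) + 1))) (1 / ((K : ℝ) + 1))) := by
    intro z
    have hε : 0 < 1 / ((K : ℝ) + 1) := by positivity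
    -- On the ball of radius ‖F z‖ + 1 the field is bounded by ‖F z‖ + K(‖F z‖ + 1), which is at
    -- most (K + 1)(‖F z‖ + 1). The ball is therefore not left before time 1/(K + 1), whatever z is.
    have hpl : IsPicardLindelof (fun _ => F) (tmin := -(1 / ((K : ℝ) + 1)))
        (tmax := 1 / ((K : ℝ) + 1)) ⟨0, by constructor <;> linarith⟩ z (‖F z‖₊ + 1) 0
        (‖F z‖₊ + K * (‖F z‖₊ + 1)) K := by
      refine IsPicardLindelof.of_time_independent ?_ hF.lipschitzOnWith ?_
      · intro x hx
        have h1 := hF.dist_le_mul x z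
        rw [Metric.mem_closedBall] at hx
        have h2 : ‖F x‖ ≤ ‖F z‖ + dist (F x) (F z) := by
          rw [dist_eq_norm]; simpa using norm_add_le (F z) (F x - F z)
        push_cast at hx ⊢
        have := mul_le_mul_of_nonneg_left hx K.coe_nonneg
        linarith
      · simp only [sub_zero, zero_sub, neg_neg, max_self]
        push_cast
        simp only [sub_zero]
        rw [mul_one_div, div_le_iff₀ (by positivity)]
        nlinarith [norm_nonneg (F z), K.coe_nonneg]
    obtain ⟨α, hα0, hα⟩ := hpl.exists_eq_forall_mem_Icc_hasDerivWithinAt₀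
    refine ⟨α, hα0, fun t ht => ?_⟩
    have := (hα t (Ioo_subset_Icc_self ht)).mono Ioo_subset_Icc_self
    exact this.hasFDerivWithinAt.hasMFDerivWithinAt
  have hglob : ∀ z : V, ∃ γ : ℝ → V, γ 0 = z ∧ IsMIntegralCurve (I := 𝓘(ℝ, V)) γ F :=
    exists_isMIntegralCurve_of_isMIntegralCurveOn (I := 𝓘(ℝ, V)) (v := F)
      (contMDiff_vectorSpace_iff_contDiff.2 hF1) (by positivity) hloc
  choose γ hγ0 hγ using hglob
  refine ⟨fun s z => γ z s, hγ0, fun s z => ?_⟩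
  have h1 : HasFDerivAt (γ z) ((1 : ℝ →L[ℝ] ℝ).smulRight (F (γ z s))) s := (hγ z s).hasFDerivAt
  exact h1.hasDerivAt.congr_deriv (by simp)

variable {F : V → V} {Φ : ℝ → V → V}

namespace IsFlow

theorem continuous (hΦ : IsFlow F Φ) (z : V) : Continuous fun s => Φ s z :=
  continuous_iff_continuousAt.2 fun s => (hΦ.hasDerivAt s z).continuousAt

theorem norm_sub_le (hΦ : IsFlow F Φ) {K : ℝ≥0} (hF : LipschitzWith K F) {s : ℝ} (hs : 0 ≤ s)
    (z w : V) : ‖Φ s z - Φ s w‖ ≤ ‖z - w‖ * Real.exp (K * s) := by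
  have := dist_le_of_trajectories_ODE (v := fun _ => F) (a := 0) (b := s) (fun _ => hF)
    (hΦ.continuous z).continuousOn (fun t _ => (hΦ.hasDerivAt t z).hasDerivWithinAt)
    (hΦ.continuous w).continuousOn (fun t _ => (hΦ.hasDerivAt t w).hasDerivWithinAt)
    (le_of_eq rfl) s ⟨hs, le_rfl⟩
  simpa [hΦ.zero, dist_eq_norm] using this

theorem add_apply (hΦ : IsFlow F Φ) {K : ℝ≥0} (hF : LipschitzWith K F) (s r : ℝ) (z : V) :
    Φ (s + r) z = Φ s (Φ r z) := by
  have h1 : ∀ t, HasDerivAt (fun σ => Φ (σ + r) z) (F (Φ (t + r) z)) t := fun t => by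
    simpa using (hΦ.hasDerivAt (t + r) z).comp_add_const t r
  have := ODE_solution_unique_univ (v := fun _ => F) (s := fun _ => univ) (t₀ := 0)
    (fun _ => hF.lipschitzOnWith) (fun t => ⟨h1 t, mem_univ _⟩)
    (fun t => ⟨hΦ.hasDerivAt t (Φ r z), mem_univ _⟩) (by simp [hΦ.zero])
  exact congrFun this s

end IsFlow

end GlobalFlow

/-! ### Partial gradients and the Hamiltonian field -/

section Hamiltonian

variable {E : Type*} [NormedAddCommGroup E] [InnerProductSpace ℝ E] [CompleteSpace E]

/-- The partial gradient of `h` in its first variable. -/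
def gradX (h : E × E → ℝ) (z : E × E) : E :=
  (InnerProductSpace.toDual ℝ E).symm ((fderiv ℝ h z).comp (ContinuousLinearMap.inl ℝ E E))

/-- The partial gradient of `h` in its second variable. -/
def gradP (h : E × E → ℝ) (z : E × E) : E :=
  (InnerProductSpace.toDual ℝ E).symm ((fderiv ℝ h z).comp (ContinuousLinearMap.inr ℝ E E))

/-- The Hamiltonian vector field of `h`. -/
def hamField (h : E × E → ℝ) (z : E × E) : E × E := (gradP h z, -gradX h z)

theorem inner_gradX (h : E × E → ℝ) (z : E × E) (a : E) :
    inner ℝ (gradX h z) a = fderiv ℝ h z (a, 0) := by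
  simp [gradX]

theorem inner_gradP (h : E × E → ℝ) (z : E × E) (a : E) :
    inner ℝ (gradP h z) a = fderiv ℝ h z (0, a) := by
  simp [gradP]

theorem fderiv_eq_inner_add_inner (h : E × E → ℝ) (z w : E × E) :
    fderiv ℝ h z w = inner ℝ (gradX h z) w.1 + inner ℝ (gradP h z) w.2 := by
  rw [inner_gradX, inner_gradP, ← map_add]; simp

theorem lipschitzWith_gradX {h : E × E → ℝ} {K : ℝ≥0} (hK : LipschitzWith K (fderiv ℝ h)) :
    LipschitzWith K (gradX h) := by
  refine LipschitzWith.of_dist_le_mul fun z w => ?_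
  rw [gradX, gradX, LinearIsometryEquiv.dist_map, dist_eq_norm, ← ContinuousLinearMap.sub_comp]
  refine (ContinuousLinearMap.opNorm_comp_le _ _).trans ?_
  have h1 := ContinuousLinearMap.norm_inl_le_one ℝ E E
  have h2 := hK.dist_le_mul z w
  rw [dist_eq_norm] at h2
  nlinarith [norm_nonneg (fderiv ℝ h z - fderiv ℝ h w)]

theorem lipschitzWith_gradP {h : E × E → ℝ} {K : ℝ≥0} (hK : LipschitzWith K (fderiv ℝ h)) :
    LipschitzWith K (gradP h) := by
  refine LipschitzWith.of_dist_le_mul fun z w => ?_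
  rw [gradP, gradP, LinearIsometryEquiv.dist_map, dist_eq_norm, ← ContinuousLinearMap.sub_comp]
  refine (ContinuousLinearMap.opNorm_comp_le _ _).trans ?_
  have h1 := ContinuousLinearMap.norm_inr_le_one ℝ E E
  have h2 := hK.dist_le_mul z w
  rw [dist_eq_norm] at h2
  nlinarith [norm_nonneg (fderiv ℝ h z - fderiv ℝ h w)]

theorem lipschitzWith_hamField {h : E × E → ℝ} {K : ℝ≥0} (hK : LipschitzWith K (fderiv ℝ h)) :
    LipschitzWith K (hamField h) := by
  simpa [hamField, Function.comp_def] using! (lipschitzWith_gradP hK).prodMk (lipschitzWith_gradX hK).neg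

theorem contDiff_hamField {h : E × E → ℝ} (hh : ContDiff ℝ 2 h) : ContDiff ℝ 1 (hamField h) := by
  have h1 : ContDiff ℝ 1 (fderiv ℝ h) := hh.fderiv_right (by norm_num)
  refine ContDiff.prodMk ?_ (ContDiff.neg ?_)
  · exact (InnerProductSpace.toDual ℝ E).symm.contDiff.comp (h1.clm_comp contDiff_const)
  · exact (InnerProductSpace.toDual ℝ E).symm.contDiff.comp (h1.clm_comp contDiff_const)

/-- The second order Taylor estimate of a function with Lipschitz derivative. -/
theorem abs_sub_sub_fderiv_le {W : Type*} [NormedAddCommGroup W] [NormedSpace ℝ W] {f : W → ℝ}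
    {K : ℝ≥0} (hf : Differentiable ℝ f) (hK : LipschitzWith K (fderiv ℝ f)) (z w : W) :
    |f w - f z - fderiv ℝ f z (w - z)| ≤ K * ‖w - z‖ ^ 2 := by
  have := (convex_segment z w).norm_image_sub_le_of_norm_hasFDerivWithin_le'
    (f := f) (f' := fderiv ℝ f) (φ := fderiv ℝ f z) (C := K * ‖w - z‖)
    (fun x _ => (hf x).hasFDerivAt.hasFDerivWithinAt)
    (fun x hx => by
      have h1 := hK.dist_le_mul x z
      rw [dist_eq_norm, dist_eq_norm] at h1
      exact h1.trans (mul_le_mul_of_nonneg_left (norm_sub_le_of_mem_segment hx) K.coe_nonneg))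
    (left_mem_segment ℝ z w) (right_mem_segment ℝ z w)
  rw [Real.norm_eq_abs] at this
  linarith

end Hamiltonian

/-! ### Surjectivity of expanding maps by continuation -/

section Surjectivity

variable {E : Type*} [NormedAddCommGroup E]

/-- Solving f y = x amounts to finding a fixed point of y ↦ f₀⁻¹(x - f y + f₀ y). The expansion of
f₀ and the smallness of f - f₀ make this map a contraction of ratio 1/2. -/
theorem surjective_of_small_lipschitz_perturbation [CompleteSpace E] {f₀ f : E → E} {c : ℝ}
    (hc : 0 < c) (h₀ : Function.Surjective f₀) (hexp : ∀ y y', c * ‖y - y'‖ ≤ ‖f₀ y - f₀ y'‖)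
    (hsmall : ∀ y y', ‖(f y - f y') - (f₀ y - f₀ y')‖ ≤ c / 2 * ‖y - y'‖) :
    Function.Surjective f := by
  intro x
  let ψ : E → E := fun y => Function.surjInv h₀ (x - f y + f₀ y)
  have hψ : ∀ y, f₀ (ψ y) = x - f y + f₀ y := fun y => Function.surjInv_eq h₀ _
  have hcontr : ContractingWith (1 / 2) ψ := by
    refine ⟨by rw [← NNReal.coe_lt_coe]; norm_num, LipschitzWith.of_dist_le_mul fun y y' => ?_⟩
    have h1 := hexp (ψ y) (ψ y')
    have h2 := hsmall y y'
    rw [hψ, hψ, show x - f y + f₀ y - (x - f y' + f₀ y') = -((f y - f y') - (f₀ y - f₀ y')) by abel,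
      norm_neg] at h1
    rw [dist_eq_norm, dist_eq_norm]
    push_cast
    have h3 : c * ‖ψ y - ψ y'‖ ≤ c * (1 / 2 * ‖y - y'‖) := by linarith
    exact le_of_mul_le_mul_left h3 hc
  have hfix : ψ (hcontr.fixedPoint ψ) = hcontr.fixedPoint ψ := hcontr.fixedPoint_isFixedPt
  refine ⟨hcontr.fixedPoint ψ, ?_⟩
  have h1 := hψ (hcontr.fixedPoint ψ)
  rw [hfix] at h1
  have h2 : x - f (hcontr.fixedPoint ψ) = 0 := by
    simpa using h1
  exact (sub_eq_zero.1 h2).symm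

/-- The continuity method: a family of uniformly expanding maps which starts at a surjective map and
is Lipschitz in time, uniformly with respect to increments, consists of surjective maps. -/
theorem surjective_of_expanding_family [CompleteSpace E] {f : ℝ → E → E} {T c M : ℝ} (hc : 0 < c)
    (hM : 0 ≤ M) (h₀ : Function.Surjective (f 0))
    (hexp : ∀ s ∈ Icc 0 T, ∀ y y', c * ‖y - y'‖ ≤ ‖f s y - f s y'‖)
    (hlip : ∀ s₀ ∈ Icc 0 T, ∀ s ∈ Icc 0 T, s₀ ≤ s → ∀ y y',
      ‖(f s y - f s y') - (f s₀ y - f s₀ y')‖ ≤ M * (s - s₀) * ‖y - y'‖) :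
    ∀ s ∈ Icc 0 T, Function.Surjective (f s) := by
  -- Over a time step δ the Lipschitz constant of the change is at most M δ ≤ c / 2, as the
  -- perturbation lemma requires. The step does not shrink, so finitely many of them reach any s.
  set δ : ℝ := c / (2 * (M + 1)) with hδ
  have hδ0 : 0 < δ := by positivity
  have hMδ : M * δ ≤ c / 2 := by
    rw [hδ, ← mul_div_assoc, div_le_div_iff₀ (by positivity) (by positivity)]
    nlinarith
  have key : ∀ n : ℕ, ∀ s ∈ Icc 0 T, s ≤ n * δ → Function.Surjective (f s) := by
    intro n
    induction n with
    | zero =>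
      intro s hs hsn
      have : s = 0 := le_antisymm (by simpa using hsn) hs.1
      rwa [this]
    | succ n ih =>
      intro s hs hsn
      push_cast at hsn
      have hmem : max 0 (s - δ) ∈ Icc 0 T :=
        ⟨le_max_left _ _, max_le (hs.1.trans hs.2) (by linarith [hs.2])⟩
      have hle : max 0 (s - δ) ≤ s := max_le hs.1 (by linarith)
      have hsurj := ih (max 0 (s - δ)) hmem
        (max_le (by positivity) (by linarith))
      refine surjective_of_small_lipschitz_perturbation hc hsurj (hexp _ hmem) fun y y' => ?_
      refine (hlip _ hmem s hs hle y y').trans ?_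
      refine mul_le_mul_of_nonneg_right (le_trans ?_ hMδ) (norm_nonneg _)
      exact mul_le_mul_of_nonneg_left (by linarith [le_max_right 0 (s - δ)]) hM
  intro s hs
  obtain ⟨n, hn⟩ := exists_nat_ge (s / δ)
  exact key n s hs ((div_le_iff₀ hδ0).1 hn)

end Surjectivity

/-! ### Barriers and uniform expansion of the characteristics -/

section Expansion

variable {E : Type*} [NormedAddCommGroup E] [InnerProductSpace ℝ E] [CompleteSpace E]

/-- `k` is a strict lower barrier on `[0, T]` for the Hessian of the solution of
`∂_s v + h(x, ∂_x v) = 0` with `v(0, ·) = g`, in integrated (monotonicity) form. -/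
structure IsBarrier (h : E × E → ℝ) (g : E → ℝ) (T : ℝ) (k k' : ℝ → ℝ) (ε : ℝ) : Prop where
  pos : 0 < ε
  hasDerivAt : ∀ s, HasDerivAt k (k' s) s
  le : ∀ s ∈ Icc 0 T, ∀ z w : E × E, k' s * ‖z.1 - w.1‖ ^ 2 ≤
    -inner ℝ (gradX h z - gradX h w) (z.1 - w.1) +
      inner ℝ (gradP h z - gradP h w) ((z.2 - w.2) - (2 * k s) • (z.1 - w.1))
  initial : ∀ y y' : E, (k 0 + ε) * ‖y - y'‖ ^ 2 ≤
    inner ℝ (gradient g y - gradient g y') (y - y')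

variable {h : E × E → ℝ} {g : E → ℝ} {T : ℝ} {k k' : ℝ → ℝ} {ε : ℝ} {Φ : ℝ → E × E → E × E}

theorem IsFlow.hasDerivAt_fst (hΦ : IsFlow (hamField h) Φ) (s : ℝ) (z : E × E) :
    HasDerivAt (fun σ => (Φ σ z).1) (gradP h (Φ s z)) s :=
  (ContinuousLinearMap.fst ℝ E E).hasFDerivAt.comp_hasDerivAt s (hΦ.hasDerivAt s z)

theorem IsFlow.hasDerivAt_snd (hΦ : IsFlow (hamField h) Φ) (s : ℝ) (z : E × E) :
    HasDerivAt (fun σ => (Φ σ z).2) (-gradX h (Φ s z)) s :=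
  (ContinuousLinearMap.snd ℝ E E).hasFDerivAt.comp_hasDerivAt s (hΦ.hasDerivAt s z)

/-- By Hamilton's equations, the derivative of this quantity is the difference of the two sides of
the barrier inequality at the two flow points. -/
theorem IsBarrier.monotoneOn (hb : IsBarrier h g T k k' ε) (hΦ : IsFlow (hamField h) Φ)
    (z w : E × E) :
    MonotoneOn (fun s => inner ℝ ((Φ s z).2 - (Φ s w).2) ((Φ s z).1 - (Φ s w).1)
      - k s * ‖(Φ s z).1 - (Φ s w).1‖ ^ 2) (Icc 0 T) := by
  have hX : ∀ s, HasDerivAt (fun s => (Φ s z).1 - (Φ s w).1)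
      (gradP h (Φ s z) - gradP h (Φ s w)) s := fun s =>
    (hΦ.hasDerivAt_fst s z).sub (hΦ.hasDerivAt_fst s w)
  have hP : ∀ s, HasDerivAt (fun s => (Φ s z).2 - (Φ s w).2)
      (-gradX h (Φ s z) - -gradX h (Φ s w)) s := fun s =>
    (hΦ.hasDerivAt_snd s z).sub (hΦ.hasDerivAt_snd s w)
  have hQ := fun s => ((hP s).inner ℝ (hX s)).sub ((hb.hasDerivAt s).mul ((hX s).norm_sq))
  refine monotoneOn_of_hasDerivWithinAt_nonneg (convex_Icc 0 T)
    (fun s _ => (hQ s).continuousAt.continuousWithinAt)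
    (fun s _ => (hQ s).hasDerivWithinAt) fun s hs => ?_
  rw [interior_Icc] at hs
  have := hb.le s (Ioo_subset_Icc_self hs) (Φ s z) (Φ s w)
  rw [inner_sub_right _ _ ((2 * k s) • _), inner_smul_right] at this
  have e1 : inner ℝ (-gradX h (Φ s z) - -gradX h (Φ s w)) ((Φ s z).1 - (Φ s w).1)
      = -inner ℝ (gradX h (Φ s z) - gradX h (Φ s w)) ((Φ s z).1 - (Φ s w).1) := by
    rw [← inner_neg_left]; congr 1; abel
  rw [e1, real_inner_comm (gradP h (Φ s z) - gradP h (Φ s w)) ((Φ s z).2 - (Φ s w).2),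
    real_inner_comm (gradP h (Φ s z) - gradP h (Φ s w)) ((Φ s z).1 - (Φ s w).1)]
  linarith

/-- The characteristic of `∂_s v + h(x, ∂_x v) = 0`, `v(0, ·) = g`, issued from `y`. -/
def charac (g : E → ℝ) (Φ : ℝ → E × E → E × E) (s : ℝ) (y : E) : E × E := Φ s (y, gradient g y)

variable {K L : ℝ≥0}

theorem exists_charac_lipschitz (hK : LipschitzWith K (fderiv ℝ h))
    (hL : LipschitzWith L (gradient g)) (hΦ : IsFlow (hamField h) Φ) (T : ℝ) :
    ∃ M : ℝ, 0 < M ∧ ∀ s ∈ Icc 0 T, ∀ y y',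
      ‖charac g Φ s y - charac g Φ s y'‖ ≤ M * ‖y - y'‖ := by
  refine ⟨(1 + L) * Real.exp (K * T), by positivity, fun s hs y y' => ?_⟩
  refine (hΦ.norm_sub_le (lipschitzWith_hamField hK) hs.1 _ _).trans ?_
  have h1 : ‖(y, gradient g y) - (y', gradient g y')‖ ≤ (1 + L) * ‖y - y'‖ := by
    have h2 := hL.dist_le_mul y y'
    rw [dist_eq_norm, dist_eq_norm] at h2
    rw [Prod.mk_sub_mk, Prod.norm_mk]
    have h3 := mul_nonneg L.coe_nonneg (norm_nonneg (y - y'))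
    exact max_le (by linarith) (by linarith [norm_nonneg (y - y')])
  have h4 : Real.exp (K * s) ≤ Real.exp (K * T) :=
    Real.exp_le_exp.2 (mul_le_mul_of_nonneg_left hs.2 K.coe_nonneg)
  calc _ ≤ ((1 + L) * ‖y - y'‖) * Real.exp (K * T) := by gcongr
    _ = _ := by ring

/-- Monotonicity from time 0 gives ε|Δy|² ≤ ⟨ΔP, ΔX⟩ - k|ΔX|². The Lipschitz bound |ΔX|, |ΔP| ≤
M|Δy| makes the right side at most (1 + |B|)M|Δy||ΔX|, and one factor |Δy| cancels. -/
theorem IsBarrier.exists_expansion (hb : IsBarrier h g T k k' ε)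
    (hK : LipschitzWith K (fderiv ℝ h)) (hL : LipschitzWith L (gradient g))
    (hΦ : IsFlow (hamField h) Φ) :
    ∃ c : ℝ, 0 < c ∧ ∀ s ∈ Icc 0 T, ∀ y y',
      c * ‖y - y'‖ ≤ ‖(charac g Φ s y).1 - (charac g Φ s y').1‖ := by
  obtain ⟨M, hM, hlip⟩ := exists_charac_lipschitz hK hL hΦ T
  have hkc : Continuous k := continuous_iff_continuousAt.2 fun s => (hb.hasDerivAt s).continuousAt
  obtain ⟨B, hB⟩ := isCompact_Icc.exists_bound_of_continuousOn (s := Icc 0 T) hkc.continuousOn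
  have hε := hb.pos
  refine ⟨ε / ((1 + |B|) * M), by positivity, fun s hs y y' => ?_⟩
  have h1 := hb.monotoneOn hΦ (y, gradient g y) (y', gradient g y')
    (⟨le_rfl, hs.1.trans hs.2⟩ : (0 : ℝ) ∈ Icc 0 T) hs hs.1
  simp only [hΦ.zero] at h1
  have h2 := hb.initial y y'
  change _ ≤ inner ℝ ((charac g Φ s y).2 - (charac g Φ s y').2)
    ((charac g Φ s y).1 - (charac g Φ s y').1) - k s *
      ‖(charac g Φ s y).1 - (charac g Φ s y').1‖ ^ 2 at h1
  have h3 := hlip s hs y y'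
  have hX := (norm_fst_le (charac g Φ s y - charac g Φ s y')).trans h3
  have hP := (norm_snd_le (charac g Φ s y - charac g Φ s y')).trans h3
  rw [Prod.fst_sub] at hX
  rw [Prod.snd_sub] at hP
  have h4 := real_inner_le_norm ((charac g Φ s y).2 - (charac g Φ s y').2)
    ((charac g Φ s y).1 - (charac g Φ s y').1)
  have h5 : -k s ≤ |B| := (neg_le_abs _).trans (((hB s hs)).trans (le_abs_self B))
  set a := ‖(charac g Φ s y).1 - (charac g Φ s y').1‖
  set b := ‖(charac g Φ s y).2 - (charac g Φ s y').2‖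
  set D := ‖y - y'‖ with hD
  have ha : 0 ≤ a := norm_nonneg _
  have hD0 : 0 ≤ D := norm_nonneg _
  have h6 : ε * D ^ 2 ≤ (1 + |B|) * M * D * a := by
    have e1 : b * a ≤ M * D * a := mul_le_mul_of_nonneg_right hP ha
    have e2 : -k s * a ^ 2 ≤ |B| * (M * D * a) := by
      have : a ^ 2 ≤ M * D * a := by rw [sq]; exact mul_le_mul_of_nonneg_right hX ha
      exact mul_le_mul h5 this (sq_nonneg a) (abs_nonneg B)
    linarith
  rcases hD0.eq_or_lt with h0 | hpos
  · rw [← h0]; simpa using ha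
  · rw [div_mul_eq_mul_div, div_le_iff₀ (by positivity)]
    have : (ε * D) * D ≤ (a * ((1 + |B|) * M)) * D := by linarith
    exact le_of_mul_le_mul_right this hpos

theorem charac_fst_surjective {c : ℝ} (hc : 0 < c)
    (hexp : ∀ s ∈ Icc 0 T, ∀ y y',
      c * ‖y - y'‖ ≤ ‖(charac g Φ s y).1 - (charac g Φ s y').1‖)
    (hK : LipschitzWith K (fderiv ℝ h)) (hL : LipschitzWith L (gradient g))
    (hΦ : IsFlow (hamField h) Φ) :
    ∀ s ∈ Icc 0 T, Function.Surjective fun y => (charac g Φ s y).1 := by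
  obtain ⟨M, hM, hlip⟩ := exists_charac_lipschitz hK hL hΦ T
  refine surjective_of_expanding_family (f := fun s y => (charac g Φ s y).1) (M := K * M)
    hc (by positivity) ?_ hexp ?_
  · intro x
    exact ⟨x, by simp [charac, hΦ.zero]⟩
  · intro s₀ hs₀ s hs hle y y'
    have hX : ∀ s, HasDerivAt (fun s => (charac g Φ s y).1 - (charac g Φ s y').1)
      (gradP h (charac g Φ s y) - gradP h (charac g Φ s y')) s := fun s =>
      (hΦ.hasDerivAt_fst s _).sub (hΦ.hasDerivAt_fst s _)
    have := (convex_Icc s₀ s).norm_image_sub_le_of_norm_hasDerivWithin_le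
      (C := K * (M * ‖y - y'‖)) (fun σ _ => (hX σ).hasDerivWithinAt)
      (fun σ hσ => by
        have h1 := (lipschitzWith_gradP hK).dist_le_mul (charac g Φ σ y) (charac g Φ σ y')
        rw [dist_eq_norm, dist_eq_norm] at h1
        exact h1.trans (mul_le_mul_of_nonneg_left
          (hlip σ ⟨hs₀.1.trans hσ.1, hσ.2.trans hs.2⟩ y y') K.coe_nonneg))
      (left_mem_Icc.2 hle) (right_mem_Icc.2 hle)
    rw [Real.norm_eq_abs, abs_of_nonneg (sub_nonneg.2 hle)] at this
    calc _ ≤ _ := this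
      _ = _ := by ring

end Expansion

theorem locallyLipschitzOn_comp {α β γ : Type*} [PseudoEMetricSpace α] [PseudoEMetricSpace β]
    [PseudoEMetricSpace γ] {s : Set α} {t : Set β} {f : β → γ} {g : α → β}
    (hf : LocallyLipschitzOn t f) (hg : LocallyLipschitzOn s g) (hst : MapsTo g s t) :
    LocallyLipschitzOn s (f ∘ g) := by
  intro x hx
  obtain ⟨K₁, U, hU, hfU⟩ := hf (hst hx)
  obtain ⟨K₂, W, hW, hgW⟩ := hg hx
  refine ⟨K₁ * K₂, W ∩ g ⁻¹' U, inter_mem hW ?_, ?_⟩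
  · exact ((hg.continuousOn x hx).tendsto_nhdsWithin hst) hU
  · exact hfU.comp (hgW.mono inter_subset_left) fun y hy => hy.2

/-! ### The differential prescribed by the equation -/

section SolDiff

variable {E : Type*} [NormedAddCommGroup E] [InnerProductSpace ℝ E] {h : E × E → ℝ}

/-- The differential of a solution of `∂_s v + h(x, ∂_x v) = 0` at `(s, x)` with `∂_x v = p`, as a
function of `(x, p)`. -/
def solDiff (h : E × E → ℝ) (z : E × E) : ℝ × E →L[ℝ] ℝ :=
  (ContinuousLinearMap.fst ℝ ℝ E).smulRight (-h z) + (innerSL ℝ z.2).comp (ContinuousLinearMap.snd ℝ ℝ E)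

theorem contDiff_solDiff (hh : ContDiff ℝ 2 h) : ContDiff ℝ 1 (solDiff h) := by
  refine ContDiff.add ?_ ?_
  · exact contDiff_const.smulRight (hh.of_le one_le_two).neg
  · exact ((innerSL ℝ).contDiff.comp contDiff_snd).clm_comp contDiff_const

end SolDiff

/-! ### Existence by the method of characteristics -/

section Value

variable {E : Type*} [NormedAddCommGroup E] [InnerProductSpace ℝ E] [CompleteSpace E]

theorem inner_gradient_eq_fderiv (g : E → ℝ) (y a : E) :
    inner ℝ (gradient g y) a = fderiv ℝ g y a := by
  simp [gradient]

theorem lipschitzWith_gradient {g : E → ℝ} {L : ℝ≥0} (hL : LipschitzWith L (fderiv ℝ g)) :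
    LipschitzWith L (gradient g) := by
  refine LipschitzWith.of_dist_le_mul fun z w => ?_
  rw [gradient, gradient, LinearIsometryEquiv.dist_map]
  exact hL.dist_le_mul z w

variable {h : E × E → ℝ} {g : E → ℝ} {T : ℝ} {Φ : ℝ → E × E → E × E} {K L : ℝ≥0}

theorem continuous_charac (hΦ : IsFlow (hamField h) Φ) (y : E) :
    Continuous fun s => charac g Φ s y := hΦ.continuous _

/-- The value carried along the characteristic issued from `y`. -/
def characValue (h : E × E → ℝ) (g : E → ℝ) (Φ : ℝ → E × E → E × E) (s : ℝ) (y : E) : ℝ :=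
  g y + ∫ σ in (0 : ℝ)..s,
    (inner ℝ (gradP h (charac g Φ σ y)) (charac g Φ σ y).2 - h (charac g Φ σ y))

theorem hasDerivAt_characValue (hh : Differentiable ℝ h) (hK : LipschitzWith K (fderiv ℝ h))
    (hΦ : IsFlow (hamField h) Φ) (s : ℝ) (y : E) :
    HasDerivAt (fun σ => characValue h g Φ σ y)
      (inner ℝ (gradP h (charac g Φ s y)) (charac g Φ s y).2 - h (charac g Φ s y)) s := by
  have hc := continuous_charac (g := g) hΦ y
  have hcont : Continuous fun σ =>
      (inner ℝ (gradP h (charac g Φ σ y)) (charac g Φ σ y).2 - h (charac g Φ σ y)) :=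
    (((lipschitzWith_gradP hK).continuous.comp hc).inner (continuous_snd.comp hc)).sub
      (hh.continuous.comp hc)
  exact ((hcont.integral_hasStrictDerivAt 0 s).hasDerivAt).const_add (g y)

/-- This is the integrated form of the identity dZ = P · dX along the family of characteristics. It
is the Taylor estimate of g at time 0, and the time derivative of the error is quadratic in the
distance of the two characteristics, hence in ‖y' - y‖. -/
theorem exists_characValue_taylor (hh : Differentiable ℝ h) (hK : LipschitzWith K (fderiv ℝ h))
    (hg : Differentiable ℝ g) (hL : LipschitzWith L (fderiv ℝ g)) (hΦ : IsFlow (hamField h) Φ)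
    (T : ℝ) :
    ∃ C : ℝ, ∀ s ∈ Icc 0 T, ∀ y y',
      |characValue h g Φ s y' - characValue h g Φ s y -
        inner ℝ (charac g Φ s y).2 ((charac g Φ s y').1 - (charac g Φ s y).1)|
        ≤ C * ‖y' - y‖ ^ 2 := by
  obtain ⟨M, hM, hlip⟩ := exists_charac_lipschitz hK (lipschitzWith_gradient hL) hΦ T
  refine ⟨L + 2 * K * M ^ 2 * T, fun s hs y y' => ?_⟩
  have hE := fun s => ((hasDerivAt_characValue (g := g) hh hK hΦ s y').sub
    (hasDerivAt_characValue (g := g) hh hK hΦ s y)).sub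
    ((hΦ.hasDerivAt_snd s (y, gradient g y)).inner ℝ
      ((hΦ.hasDerivAt_fst s (y', gradient g y')).sub (hΦ.hasDerivAt_fst s (y, gradient g y))))
  have hbound := (convex_Icc 0 s).norm_image_sub_le_of_norm_hasDerivWithin_le
      (C := 2 * K * M ^ 2 * ‖y' - y‖ ^ 2) (fun σ _ => (hE σ).hasDerivWithinAt)
      (fun σ hσ => by
        have hl := hlip σ ⟨hσ.1, hσ.2.trans hs.2⟩ y' y
        change ‖inner ℝ (gradP h (charac g Φ σ y')) (charac g Φ σ y').2 - h (charac g Φ σ y')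
          - (inner ℝ (gradP h (charac g Φ σ y)) (charac g Φ σ y).2 - h (charac g Φ σ y))
          - (inner ℝ (charac g Φ σ y).2 (gradP h (charac g Φ σ y') - gradP h (charac g Φ σ y))
            + inner ℝ (-gradX h (charac g Φ σ y)) ((charac g Φ σ y').1 - (charac g Φ σ y).1))‖ ≤ _
        set z := charac g Φ σ y
        set w := charac g Φ σ y'
        have h1 := abs_sub_sub_fderiv_le hh hK z w
        rw [fderiv_eq_inner_add_inner] at h1
        have h2 := (lipschitzWith_gradP hK).dist_le_mul w z
        rw [dist_eq_norm, dist_eq_norm] at h2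
        have h3 := abs_real_inner_le_norm (gradP h w - gradP h z) (w.2 - z.2)
        have h4 : ‖w.2 - z.2‖ ≤ ‖w - z‖ := norm_snd_le (w - z)
        have h5 : ‖gradP h w - gradP h z‖ * ‖w.2 - z.2‖ ≤ K * ‖w - z‖ * ‖w - z‖ :=
          mul_le_mul h2 h4 (norm_nonneg _) (by positivity)
        have h6 : ‖w - z‖ ^ 2 ≤ (M * ‖y' - y‖) ^ 2 := by gcongr
        have h7 := mul_le_mul_of_nonneg_left h6 K.coe_nonneg
        -- All first-order terms cancel. What remains is a product of two increments and the Taylor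
        -- remainder of h.
        have e : inner ℝ (gradP h w) w.2 - h w - (inner ℝ (gradP h z) z.2 - h z)
          - (inner ℝ z.2 (gradP h w - gradP h z) + inner ℝ (-gradX h z) (w.1 - z.1))
          = inner ℝ (gradP h w - gradP h z) (w.2 - z.2)
            - (h w - h z - (inner ℝ (gradX h z) (w - z).1 + inner ℝ (gradP h z) (w - z).2)) := by
          simp only [inner_sub_left, inner_sub_right, inner_neg_left, Prod.fst_sub, Prod.snd_sub]
          rw [real_inner_comm (gradP h w) z.2, real_inner_comm (gradP h z) z.2]
          ring
        rw [e, Real.norm_eq_abs]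
        refine (abs_sub _ _).trans ?_
        nlinarith)
      (left_mem_Icc.2 hs.1) (right_mem_Icc.2 hs.1)
  have h0 := abs_sub_sub_fderiv_le hg hL y y'
  rw [← inner_gradient_eq_fderiv] at h0
  simp only [Pi.sub_apply, hΦ.zero] at hbound
  have e0 : ∀ y, characValue h g Φ 0 y = g y := fun y => by simp [characValue]
  rw [e0, e0, sub_zero] at hbound
  change ‖characValue h g Φ s y' - characValue h g Φ s y -
        inner ℝ (charac g Φ s y).2 ((charac g Φ s y').1 - (charac g Φ s y).1) - _‖ ≤ _ at hbound
  rw [Real.norm_eq_abs, Real.norm_eq_abs, abs_of_nonneg hs.1] at hbound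
  have h8 : 2 * K * M ^ 2 * ‖y' - y‖ ^ 2 * s ≤ 2 * K * M ^ 2 * ‖y' - y‖ ^ 2 * T :=
    mul_le_mul_of_nonneg_left hs.2 (by positivity)
  have h9 := abs_add_le (characValue h g Φ s y' - characValue h g Φ s y -
        inner ℝ (charac g Φ s y).2 ((charac g Φ s y').1 - (charac g Φ s y).1)
        - (g y' - g y - inner ℝ (gradient g y) (y' - y))) (g y' - g y - inner ℝ (gradient g y) (y' - y))
  rw [sub_add_cancel] at h9
  linarith

/-- The characteristics are Lipschitz in time, uniformly for bounded starting points. -/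
theorem exists_charac_time_lipschitz (hK : LipschitzWith K (fderiv ℝ h))
    (hL : LipschitzWith L (gradient g)) (hΦ : IsFlow (hamField h) Φ) (T R : ℝ) :
    ∃ B : ℝ, 0 ≤ B ∧ ∀ y, ‖y‖ ≤ R → ∀ s ∈ Icc 0 T, ∀ s' ∈ Icc 0 T,
      ‖charac g Φ s y - charac g Φ s' y‖ ≤ B * |s - s'| := by
  obtain ⟨M, hM, hlip⟩ := exists_charac_lipschitz hK hL hΦ T
  have hF := lipschitzWith_hamField hK
  obtain ⟨B, hB⟩ := isCompact_Icc.exists_bound_of_continuousOn (s := Icc 0 T)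
    (hF.continuous.comp (continuous_charac (g := g) hΦ 0)).continuousOn
  refine ⟨|B| + K * (M * |R|), by positivity, fun y hy s hs s' hs' => ?_⟩
  refine (convex_Icc 0 T).norm_image_sub_le_of_norm_hasDerivWithin_le
    (fun σ _ => (hΦ.hasDerivAt σ (y, gradient g y)).hasDerivWithinAt) (fun σ hσ => ?_) hs' hs
  have h1 := hF.dist_le_mul (charac g Φ σ y) (charac g Φ σ 0)
  rw [dist_eq_norm, dist_eq_norm] at h1
  have h2 := hlip σ hσ y 0
  rw [sub_zero] at h2
  have h3 : K * ‖charac g Φ σ y - charac g Φ σ 0‖ ≤ K * (M * |R|) := by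
    refine mul_le_mul_of_nonneg_left (h2.trans ?_) K.coe_nonneg
    exact mul_le_mul_of_nonneg_left (hy.trans (le_abs_self R)) hM.le
  have h4 := norm_add_le (hamField h (charac g Φ σ y) - hamField h (charac g Φ σ 0))
    (hamField h (charac g Φ σ 0))
  rw [sub_add_cancel] at h4
  have h5 : ‖hamField h (charac g Φ σ 0)‖ ≤ |B| := (hB σ hσ).trans (le_abs_self B)
  change ‖hamField h (charac g Φ σ y)‖ ≤ _
  linarith

/-- The method of characteristics: if the space components of the characteristics are uniformly
expanding, then the problem `∂_s v + h(x, ∂_x v) = 0`, `v(0, ·) = g` has a solution on `[0, T]` whose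
space gradient `p` is locally Lipschitz. -/
theorem exists_solution_of_expansion (hh : Differentiable ℝ h) (hK : LipschitzWith K (fderiv ℝ h))
    (hg : Differentiable ℝ g) (hL : LipschitzWith L (fderiv ℝ g)) (hΦ : IsFlow (hamField h) Φ)
    {c : ℝ} (hc : 0 < c)
    (hexp : ∀ s ∈ Icc 0 T, ∀ y y',
      c * ‖y - y'‖ ≤ ‖(charac g Φ s y).1 - (charac g Φ s y').1‖) :
    ∃ (v : ℝ × E → ℝ) (p : ℝ × E → E),
      (∀ q ∈ Icc 0 T ×ˢ univ, HasFDerivWithinAt v (solDiff h (q.2, p q)) (Icc 0 T ×ˢ univ) q) ∧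
      LocallyLipschitzOn (Icc 0 T ×ˢ univ) p ∧
      ∀ s ∈ Icc 0 T, ∀ y, v (s, (charac g Φ s y).1) = characValue h g Φ s y := by
  have hLg := lipschitzWith_gradient hL
  have hsurj := charac_fst_surjective hc hexp hK hLg hΦ
  let Y : ℝ → E → E := fun s => Function.invFun fun y => (charac g Φ s y).1
  have hXY : ∀ s ∈ Icc 0 T, ∀ x, (charac g Φ s (Y s x)).1 = x := fun s hs x =>
    Function.invFun_eq (hsurj s hs x)
  have hYX : ∀ s ∈ Icc 0 T, ∀ y, Y s (charac g Φ s y).1 = y := fun s hs y => by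
    have h1 := hexp s hs (Y s (charac g Φ s y).1) y
    rw [hXY s hs, sub_self, norm_zero] at h1
    have h2 : ‖Y s (charac g Φ s y).1 - y‖ ≤ 0 := by
      by_contra hcon
      push Not at hcon
      nlinarith
    exact sub_eq_zero.1 (norm_le_zero_iff.1 h2)
  let v : ℝ × E → ℝ := fun q => characValue h g Φ q.1 (Y q.1 q.2)
  let p : ℝ × E → E := fun q => (charac g Φ q.1 (Y q.1 q.2)).2
  refine ⟨v, p, ?_, ?_, fun s hs y => by simp only [v, hYX s hs]⟩
  · obtain ⟨C, hC⟩ := exists_characValue_taylor hh hK hg hL hΦ T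
    rintro ⟨s, x⟩ ⟨hs, -⟩
    simp only at hs
    obtain ⟨y, hy⟩ : ∃ y, y = Y s x := ⟨_, rfl⟩
    have hxy : (charac g Φ s y).1 = x := by rw [hy]; exact hXY s hs x
    -- the affine approximation based at the characteristic through `(s, x)`
    let r : ℝ × E → E := fun q => q.2 - (charac g Φ q.1 y).1
    let ψ : ℝ × E → ℝ := fun q =>
      characValue h g Φ q.1 y + inner ℝ (charac g Φ q.1 y).2 (r q)
    have hr0 : r (s, x) = 0 := by simp [r, hxy]
    have hfst : HasFDerivAt (fun q : ℝ × E => q.1) (ContinuousLinearMap.fst ℝ ℝ E) (s, x) :=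
      hasFDerivAt_fst
    have hX' : HasFDerivAt (fun σ => (charac g Φ σ y).1)
      (ContinuousLinearMap.toSpanSingleton ℝ (gradP h (charac g Φ s y))) s :=
      hΦ.hasDerivAt_fst s (y, gradient g y)
    have hP' : HasFDerivAt (fun σ => (charac g Φ σ y).2)
      (ContinuousLinearMap.toSpanSingleton ℝ (-gradX h (charac g Φ s y))) s :=
      hΦ.hasDerivAt_snd s (y, gradient g y)
    have hr : HasFDerivAt r (ContinuousLinearMap.snd ℝ ℝ E -
        (ContinuousLinearMap.toSpanSingleton ℝ (gradP h (charac g Φ s y))).comp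
          (ContinuousLinearMap.fst ℝ ℝ E)) (s, x) :=
      hasFDerivAt_snd.sub (HasFDerivAt.comp (s, x) (f := fun q : ℝ × E => q.1) hX' hfst)
    have hZ : HasFDerivAt (fun q : ℝ × E => characValue h g Φ q.1 y) _ (s, x) :=
      HasFDerivAt.comp (s, x) (f := fun q : ℝ × E => q.1)
        (hasDerivAt_characValue (g := g) hh hK hΦ s y).hasFDerivAt hfst
    have hP : HasFDerivAt (fun q : ℝ × E => (charac g Φ q.1 y).2) _ (s, x) :=
      HasFDerivAt.comp (s, x) (f := fun q : ℝ × E => q.1) hP' hfst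
    have hψ : HasFDerivAt ψ (solDiff h (x, p (s, x))) (s, x) := by
      refine (hZ.add (hP.inner ℝ hr)).congr_fderiv ?_
      have hz : charac g Φ s y = (x, p (s, x)) := Prod.ext hxy (by simp [p, hy])
      ext1
      · ext1
        simp [solDiff, hr0, hz, fderivInnerCLM_apply, real_inner_comm]
        ring
      · ext1
        simp [solDiff, hr0, hz, fderivInnerCLM_apply]
    -- The Taylor estimate at time s' is quadratic in Y s' x' - y, and expansion bounds this by r /
    -- c. So v differs from the smooth ψ by O(‖r‖²), where r vanishes at (s, x); both have the same
    -- differential there.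
    have hR : ∀ q ∈ Icc 0 T ×ˢ (univ : Set E), ‖v q - ψ q‖ ≤ (|C| / c ^ 2) * ‖r q‖ ^ 2 := by
      rintro ⟨s', x'⟩ ⟨hs', -⟩
      simp only at hs'
      have h1 := hC s' hs' y (Y s' x')
      rw [hXY s' hs'] at h1
      have h2 := hexp s' hs' (Y s' x') y
      rw [hXY s' hs'] at h2
      have h3 : (c * ‖Y s' x' - y‖) ^ 2 ≤ ‖x' - (charac g Φ s' y).1‖ ^ 2 := by gcongr
      simp only [v, ψ, r, Real.norm_eq_abs]
      rw [← sub_sub]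
      refine h1.trans ?_
      rw [div_mul_eq_mul_div, le_div_iff₀ (by positivity)]
      calc C * ‖Y s' x' - y‖ ^ 2 * c ^ 2 = C * (c * ‖Y s' x' - y‖) ^ 2 := by ring
        _ ≤ |C| * (c * ‖Y s' x' - y‖) ^ 2 := by gcongr; exact le_abs_self C
        _ ≤ _ := by gcongr
    have hlittle : HasFDerivWithinAt (fun q => v q - ψ q) (0 : ℝ × E →L[ℝ] ℝ)
        (Icc 0 T ×ˢ univ) (s, x) := by
      refine HasFDerivWithinAt.of_isLittleO ?_
      have hv0 : v (s, x) - ψ (s, x) = 0 := by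
        have := hR (s, x) ⟨hs, mem_univ _⟩
        rw [hr0] at this
        simpa using this
      have hO : r =O[𝓝 (s, x)] fun q => q - (s, x) := by
        simpa [hr0] using hr.isBigO_sub
      have ho : (fun q => ‖r q‖ ^ 2) =o[𝓝 (s, x)] fun q => q - (s, x) := by
        have h1 : (fun q : ℝ × E => ‖r q‖ ^ 2) =O[𝓝 (s, x)] fun q => ‖q - (s, x)‖ ^ 2 :=
          hO.norm_norm.pow 2
        refine h1.trans_isLittleO ?_
        have h2 := (Asymptotics.isLittleO_norm_pow_id (E' := ℝ × E) one_lt_two).comp_tendsto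
          (show Tendsto (fun q : ℝ × E => q - (s, x)) (𝓝 (s, x)) (𝓝 0) from by
            exact tendsto_sub_nhds_zero_iff.2 tendsto_id)
        exact h2
      have hbig : (fun q => v q - ψ q) =O[𝓝[Icc 0 T ×ˢ univ] (s, x)] fun q => ‖r q‖ ^ 2 :=
        Asymptotics.IsBigO.of_bound (|C| / c ^ 2) (eventually_mem_nhdsWithin.mono fun q hq => by
          simpa using hR q hq)
      simpa [hv0] using hbig.trans_isLittleO (ho.mono nhdsWithin_le_nhds)
    have := hψ.hasFDerivWithinAt.add hlittle
    rw [add_zero] at this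
    exact this.congr_of_eventuallyEq (Eventually.of_forall fun q => by simp) (by simp)
  · obtain ⟨M, hM, hlip⟩ := exists_charac_lipschitz hK hLg hΦ T
    rintro ⟨s₀, x₀⟩ ⟨hs₀, -⟩
    obtain ⟨B₀, hB₀⟩ := isCompact_Icc.exists_bound_of_continuousOn (s := Icc 0 T)
      (continuous_fst.comp (continuous_charac (g := g) hΦ 0)).continuousOn
    -- The radius bounds the starting points Y s x for all s in [0, T] and x in the unit ball about
    -- x₀, by expansion relative to the characteristic issued from 0.
    obtain ⟨B, hB, htime⟩ := exists_charac_time_lipschitz hK hLg hΦ T ((‖x₀‖ + 1 + B₀) / c)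
    refine ⟨Real.toNNReal (M * ((1 + B) / c) + B), (Icc 0 T ×ˢ univ) ∩ (univ ×ˢ Metric.ball x₀ 1),
      inter_mem self_mem_nhdsWithin (mem_nhdsWithin_of_mem_nhds
        (prod_mem_nhds univ_mem (Metric.ball_mem_nhds x₀ one_pos))), ?_⟩
    refine LipschitzOnWith.of_dist_le_mul ?_
    rintro ⟨s', x'⟩ ⟨⟨hs', -⟩, -, hx'⟩ ⟨s, x⟩ ⟨⟨hs, -⟩, -, hx⟩
    simp only at hs hs' hx hx'
    rw [Real.coe_toNNReal _ (by positivity)]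
    have hYb : ‖Y s x‖ ≤ (‖x₀‖ + 1 + B₀) / c := by
      rw [le_div_iff₀ hc]
      have h1 := hexp s hs (Y s x) 0
      rw [hXY s hs, sub_zero] at h1
      have h2 := norm_sub_le x (charac g Φ s 0).1
      have h3 : ‖(charac g Φ s 0).1‖ ≤ B₀ := hB₀ s hs
      have h4 : ‖x‖ ≤ ‖x₀‖ + 1 := by
        rw [Metric.mem_ball, dist_eq_norm] at hx
        have := norm_add_le x₀ (x - x₀)
        rw [add_sub_cancel] at this
        linarith
      linarith
    have ht := htime (Y s x) hYb s' hs' s hs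
    have hd1 : |s' - s| ≤ dist (s', x') (s, x) := le_max_left _ _
    have hd2 : ‖x' - x‖ ≤ dist (s', x') (s, x) := by
      rw [← dist_eq_norm]; exact le_max_right _ _
    -- Expansion is applied at the single time s', after moving the characteristic from Y s x there
    -- at the cost of B|s' - s|.
    have hYY : ‖Y s' x' - Y s x‖ ≤ (1 + B) / c * dist (s', x') (s, x) := by
      have h1 := hexp s' hs' (Y s' x') (Y s x)
      rw [hXY s' hs'] at h1
      have h2 := (norm_fst_le _).trans ht
      rw [Prod.fst_sub, hXY s hs] at h2
      have h3 := norm_sub_le (x' - x) ((charac g Φ s' (Y s x)).1 - x)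
      rw [sub_sub_sub_cancel_right] at h3
      rw [div_mul_eq_mul_div, le_div_iff₀ hc]
      nlinarith
    have h1 := (norm_snd_le _).trans (hlip s' hs' (Y s' x') (Y s x))
    have h2 := (norm_snd_le _).trans ht
    have h3 := norm_add_le ((charac g Φ s' (Y s' x')).2 - (charac g Φ s' (Y s x)).2)
      ((charac g Φ s' (Y s x)).2 - (charac g Φ s (Y s x)).2)
    rw [sub_add_sub_cancel] at h3
    rw [dist_eq_norm]
    change ‖(charac g Φ s' (Y s' x')).2 - (charac g Φ s (Y s x)).2‖ ≤ _
    rw [Prod.snd_sub] at h1 h2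
    have h4 := mul_le_mul_of_nonneg_left hYY hM.le
    have h5 := mul_le_mul_of_nonneg_left hd1 hB
    linarith

end Value

/-- A backward Grönwall lemma in increment form. -/
theorem eq_zero_of_norm_increment_le {V : Type*} [NormedAddCommGroup V] {w : ℝ → V} {s C : ℝ}
    (hw : ContinuousOn w (Icc 0 s)) (hws : w s = 0) (hC : 0 ≤ C)
    (hinc : ∀ a b m, 0 ≤ a → a ≤ b → b ≤ s → (∀ σ ∈ Icc a b, ‖w σ‖ ≤ m) →
      ‖w b - w a‖ ≤ C * m * (b - a)) :
    ∀ σ ∈ Icc 0 s, w σ = 0 := by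
  set δ : ℝ := 1 / (2 * (C + 1)) with hδ
  have hδ0 : 0 < δ := by positivity
  have hCδ : C * δ ≤ 1 / 2 := by
    rw [hδ, mul_one_div, div_le_div_iff₀ (by positivity) (by positivity)]
    linarith
  have key : ∀ n : ℕ, ∀ σ ∈ Icc 0 s, s - n * δ ≤ σ → w σ = 0 := by
    intro n
    induction n with
    | zero =>
      intro σ hσ hle
      have : σ = s := le_antisymm hσ.2 (by simpa using hle)
      rwa [this]
    | succ n ih =>
      intro σ hσ hle
      push_cast at hle
      set b := min s (σ + δ) with hb
      have hσb : σ ≤ b := le_min hσ.2 (by linarith)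
      have hwb : w b = 0 := by
        refine ih b ⟨hσ.1.trans hσb, min_le_left _ _⟩ (le_min ?_ (by linarith))
        have : (0 : ℝ) ≤ n * δ := by positivity
        linarith
      have hsub : Icc σ b ⊆ Icc 0 s := Icc_subset_Icc hσ.1 (min_le_left _ _)
      -- Comparing the maximum of ‖w‖ on [σ, b] with w b = 0 gives ‖w τ‖ ≤ ‖w τ‖ / 2, so w vanishes
      -- on the whole interval.
      obtain ⟨τ, hτ, hmax⟩ := isCompact_Icc.exists_isMaxOn (nonempty_Icc.2 hσb)
        (hw.mono hsub).norm
      have h1 := hinc τ b ‖w τ‖ (hsub hτ).1 hτ.2 (min_le_left _ _)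
        fun r hr => hmax ⟨hτ.1.trans hr.1, hr.2⟩
      rw [hwb, zero_sub, norm_neg] at h1
      have h2 : b - τ ≤ δ := by linarith [hτ.1, min_le_right s (σ + δ)]
      have h3 : C * ‖w τ‖ * (b - τ) ≤ 1 / 2 * ‖w τ‖ := by
        calc C * ‖w τ‖ * (b - τ) ≤ C * ‖w τ‖ * δ := by gcongr
          _ = C * δ * ‖w τ‖ := by ring
          _ ≤ 1 / 2 * ‖w τ‖ := by gcongr
      have h4 : ‖w τ‖ ≤ 0 := by linarith
      exact norm_le_zero_iff.1 ((hmax (left_mem_Icc.2 hσb)).trans h4)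
  intro σ hσ
  obtain ⟨n, hn⟩ := exists_nat_ge (s / δ)
  have := (div_le_iff₀ hδ0).1 hn
  exact key n σ hσ (by linarith [hσ.1])

theorem norm_le_of_hasDerivAt_of_le {F : ℝ → ℝ} {D A B : ℝ} (hF : HasDerivAt F D 0)
    (h0 : F 0 = 0) (hle : ∀ η ∈ Ioc (0 : ℝ) 1, |F η| ≤ A * η + B * η ^ 2) : |D| ≤ A := by
  have h1 := hF.tendsto_slope_zero_right.norm
  have h2 : Tendsto (fun η : ℝ => A + B * η) (𝓝[>] 0) (𝓝 A) := by
    have : Continuous fun η : ℝ => A + B * η := by fun_prop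
    simpa using (this.tendsto 0).mono_left nhdsWithin_le_nhds
  refine le_of_tendsto_of_tendsto h1 h2 ?_
  filter_upwards [Ioc_mem_nhdsGT (zero_lt_one' ℝ)] with η hη
  have h3 := hle η hη
  rw [zero_add, h0, sub_zero, norm_smul, norm_inv, Real.norm_eq_abs, Real.norm_eq_abs,
    abs_of_pos hη.1, inv_mul_le_iff₀ hη.1]
  linarith

/-! ### Uniqueness: every solution follows the characteristics -/

section Uniqueness

variable {E : Type*} [NormedAddCommGroup E] [InnerProductSpace ℝ E]
  {h : E × E → ℝ} {g : E → ℝ} {T : ℝ} {Φ : ℝ → E × E → E × E} {K : ℝ≥0}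
  {v : ℝ × E → ℝ} {p : ℝ × E → E}

theorem hasDerivWithinAt_solution_along {s : ℝ} (hs : s ≤ T)
    (hv : ∀ q ∈ Icc 0 T ×ˢ univ, HasFDerivWithinAt v (solDiff h (q.2, p q)) (Icc 0 T ×ˢ univ) q)
    {x : ℝ → E} {x' : E} {σ : ℝ} (hσ : σ ∈ Icc 0 s) (hx : HasDerivAt x x' σ) :
    HasDerivWithinAt (fun σ => v (σ, x σ))
      (-h (x σ, p (σ, x σ)) + inner ℝ (p (σ, x σ)) x') (Icc 0 s) σ := by
  have h1 := (hv (σ, x σ) ⟨⟨hσ.1, hσ.2.trans hs⟩, mem_univ _⟩).comp_hasDerivWithinAt σ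
    (((hasDerivAt_id σ).prodMk hx).hasDerivWithinAt (s := Icc 0 s))
    (fun r hr => mk_mem_prod (show r ∈ Icc 0 T from ⟨hr.1, hr.2.trans hs⟩) (mem_univ _))
  refine h1.congr_deriv ?_
  simp [solDiff]

variable [CompleteSpace E]
/-- The space gradient of a `C^{1,1}` solution is transported by the Hamiltonian flow. -/
theorem gradient_eq_along_flow [ProperSpace E] (hh : Differentiable ℝ h)
    (hK : LipschitzWith K (fderiv ℝ h))
    (hv : ∀ q ∈ Icc 0 T ×ˢ univ, HasFDerivWithinAt v (solDiff h (q.2, p q)) (Icc 0 T ×ˢ univ) q)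
    (hp : LocallyLipschitzOn (Icc 0 T ×ˢ univ) p) {s : ℝ} (hs : s ≤ T)
    {ζ : ℝ → E × E} (hζ : ∀ σ, HasDerivAt ζ (hamField h (ζ σ)) σ)
    (hζs : p (s, (ζ s).1) = (ζ s).2) :
    ∀ σ ∈ Icc 0 s, p (σ, (ζ σ).1) = (ζ σ).2 := by
  have hX : ∀ σ, HasDerivAt (fun σ => (ζ σ).1) (gradP h (ζ σ)) σ := fun σ =>
    (ContinuousLinearMap.fst ℝ E E).hasFDerivAt.comp_hasDerivAt σ (hζ σ)
  have hP : ∀ σ, HasDerivAt (fun σ => (ζ σ).2) (-gradX h (ζ σ)) σ := fun σ =>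
    (ContinuousLinearMap.snd ℝ E E).hasFDerivAt.comp_hasDerivAt σ (hζ σ)
  have hζc : Continuous ζ := continuous_iff_continuousAt.2 fun σ => (hζ σ).continuousAt
  obtain ⟨R, hR⟩ := isCompact_Icc.exists_bound_of_continuousOn (s := Icc 0 s)
    (continuous_fst.comp hζc).continuousOn
  -- The extra 1 in the radius leaves room for the shifts η • e with η ≤ 1 and ‖e‖ ≤ 1.
  obtain ⟨Λ, hΛ⟩ := (hp.mono (show Icc 0 T ×ˢ Metric.closedBall (0 : E) (R + 1) ⊆ Icc 0 T ×ˢ univ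
    from prod_mono subset_rfl (subset_univ _))).exists_lipschitzOnWith_of_compact
    (isCompact_Icc.prod (isCompact_closedBall _ _))
  have hpc : ContinuousOn (fun σ => p (σ, (ζ σ).1)) (Icc 0 s) :=
    hp.continuousOn.comp (continuous_id.prodMk (continuous_fst.comp hζc)).continuousOn
      fun r hr => ⟨⟨hr.1, hr.2.trans hs⟩, mem_univ _⟩
  set w : ℝ → E := fun σ => p (σ, (ζ σ).1) - (ζ σ).2 with hwdef
  suffices hw0 : ∀ σ ∈ Icc 0 s, w σ = 0 from fun σ hσ => sub_eq_zero.1 (hw0 σ hσ)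
  refine eq_zero_of_norm_increment_le (C := K * (1 + Λ))
    (hpc.sub (continuous_snd.comp hζc).continuousOn) (by simp [hwdef, hζs]) (by positivity) ?_
  intro a b m ha hab hbs hm
  have hm0 : 0 ≤ m := (norm_nonneg _).trans (hm a (left_mem_Icc.2 hab))
  have hmem : ∀ σ ∈ Icc a b, σ ∈ Icc 0 s := fun σ hσ => ⟨ha.trans hσ.1, hσ.2.trans hbs⟩
  -- the increment in an arbitrary direction of norm at most one
  have key : ∀ e : E, ‖e‖ ≤ 1 → |inner ℝ (w b - w a) e| ≤ K * (1 + Λ) * m * (b - a) := by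
    intro e he
    -- The derivative of f at η = 0 is ⟨w σ, e⟩, whereas its σ-derivative involves only first
    -- derivatives of v. Increments of w are thus estimated without second derivatives of v.
    let f : ℝ → ℝ → ℝ := fun η σ =>
      v (σ, (ζ σ).1 + η • e) - v (σ, (ζ σ).1) - η * inner ℝ (ζ σ).2 e
    have hf0 : ∀ σ, f 0 σ = 0 := fun σ => by simp [f]
    have hderiv : ∀ σ ∈ Icc 0 s, HasDerivAt (fun η => f η σ) (inner ℝ (w σ) e) 0 := by
      intro σ hσ
      have hline : HasDerivAt (fun η : ℝ => (σ, (ζ σ).1 + η • e)) ((0 : ℝ), e) 0 := by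
        simpa using (hasDerivAt_const (0 : ℝ) σ).prodMk
          (((hasDerivAt_id (0 : ℝ)).smul_const e).const_add (ζ σ).1)
      have h1 := (hv (σ, (ζ σ).1 + (0 : ℝ) • e) ⟨⟨hσ.1, hσ.2.trans hs⟩, mem_univ _⟩
        ).comp_hasDerivWithinAt (s := univ) 0 hline.hasDerivWithinAt
        fun r _ => mk_mem_prod (show σ ∈ Icc 0 T from ⟨hσ.1, hσ.2.trans hs⟩) (mem_univ _)
      rw [hasDerivWithinAt_univ] at h1
      have h2 := (h1.sub_const (v (σ, (ζ σ).1))).sub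
        ((hasDerivAt_id (0 : ℝ)).mul_const (inner ℝ (ζ σ).2 e))
      refine h2.congr_deriv ?_
      simp [solDiff, hwdef, inner_sub_left]
    have hbound : ∀ η ∈ Ioc (0 : ℝ) 1, |f η b - f η a| ≤
        (K * (1 + Λ) * m * (b - a)) * η + (K * (1 + Λ) ^ 2 * (b - a)) * η ^ 2 := by
      intro η hη
      have hfd : ∀ σ ∈ Icc 0 s, HasDerivWithinAt (f η) _ (Icc 0 s) σ := fun σ hσ =>
        ((hasDerivWithinAt_solution_along hs hv hσ ((hX σ).add_const (η • e))).sub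
          (hasDerivWithinAt_solution_along hs hv hσ (hX σ))).sub
          (((hP σ).inner ℝ (hasDerivAt_const σ e)).const_mul η).hasDerivWithinAt
      have := (convex_Icc a b).norm_image_sub_le_of_norm_hasDerivWithin_le
        (C := K * (1 + Λ) * m * η + K * (1 + Λ) ^ 2 * η ^ 2)
        (fun σ hσ => (hfd σ (hmem σ hσ)).mono (Icc_subset_Icc ha hbs)) (fun σ hσ => ?_)
        (left_mem_Icc.2 hab) (right_mem_Icc.2 hab)
      · rw [Real.norm_eq_abs, Real.norm_eq_abs, abs_of_nonneg (sub_nonneg.2 hab)] at this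
        linarith
      · have hσs := hmem σ hσ
        have hηe : ‖η • e‖ ≤ η := by
          rw [norm_smul, Real.norm_eq_abs, abs_of_pos hη.1]
          exact mul_le_of_le_one_right hη.1.le he
        have hRσ : ‖(ζ σ).1‖ ≤ R := hR σ hσs
        have hq : ‖p (σ, (ζ σ).1 + η • e) - p (σ, (ζ σ).1)‖ ≤ Λ * η := by
          have h1 := hΛ.dist_le_mul (σ, (ζ σ).1 + η • e) ⟨⟨hσs.1, hσs.2.trans hs⟩, by
              rw [mem_closedBall_zero_iff]
              exact (norm_add_le _ _).trans (by linarith [hη.2])⟩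
            (σ, (ζ σ).1) ⟨⟨hσs.1, hσs.2.trans hs⟩, by
              rw [mem_closedBall_zero_iff]
              linarith⟩
          rw [dist_eq_norm, dist_eq_norm, Prod.mk_sub_mk, Prod.norm_mk] at h1
          simp only [sub_self, norm_zero, add_sub_cancel_left, norm_nonneg, sup_of_le_right] at h1
          exact h1.trans (mul_le_mul_of_nonneg_left hηe Λ.coe_nonneg)
        have hwσ : ‖p (σ, (ζ σ).1) - (ζ σ).2‖ ≤ m := hm σ hσ
        set q := p (σ, (ζ σ).1)
        set q' := p (σ, (ζ σ).1 + η • e)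
        set x := (ζ σ).1
        have hzz : ‖(x, q) - ζ σ‖ ≤ m := by
          have : (x, q) - ζ σ = (0, q - (ζ σ).2) := by ext1 <;> simp [x]
          rw [this, Prod.norm_mk]
          simpa using hwσ
        have hT := abs_sub_sub_fderiv_le hh hK (x, q) (x + η • e, q')
        rw [fderiv_eq_inner_add_inner] at hT
        simp only [Prod.mk_sub_mk, add_sub_cancel_left, Prod.norm_mk] at hT
        have hmax : max ‖η • e‖ ‖q' - q‖ ≤ (1 + Λ) * η := by
          have := mul_nonneg Λ.coe_nonneg hη.1.le
          exact max_le (by linarith) (by linarith [hη.1])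
        have hmax2 : K * max ‖η • e‖ ‖q' - q‖ ^ 2 ≤ K * ((1 + Λ) * η) ^ 2 := by gcongr
        have hgX : ‖gradX h (x, q) - gradX h (ζ σ)‖ ≤ K * m := by
          have := (lipschitzWith_gradX hK).dist_le_mul (x, q) (ζ σ)
          rw [dist_eq_norm, dist_eq_norm] at this
          exact this.trans (mul_le_mul_of_nonneg_left hzz K.coe_nonneg)
        have hgP : ‖gradP h (x, q) - gradP h (ζ σ)‖ ≤ K * m := by
          have := (lipschitzWith_gradP hK).dist_le_mul (x, q) (ζ σ)
          rw [dist_eq_norm, dist_eq_norm] at this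
          exact this.trans (mul_le_mul_of_nonneg_left hzz K.coe_nonneg)
        have hi1 : |inner ℝ (gradX h (x, q) - gradX h (ζ σ)) (η • e)| ≤ K * m * η :=
          (abs_real_inner_le_norm _ _).trans (mul_le_mul hgX hηe (norm_nonneg _) (by positivity))
        have hi2 : |inner ℝ (gradP h (x, q) - gradP h (ζ σ)) (q' - q)| ≤ K * m * (Λ * η) :=
          (abs_real_inner_le_norm _ _).trans (mul_le_mul hgP hq (norm_nonneg _) (by positivity))
        -- The σ-derivative of f η splits into a Taylor remainder of h, of order η², and two terms
        -- of order m η. Only the latter survive division by η as η → 0.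
        have e1 : -h (x + η • e, q') + inner ℝ q' (gradP h (ζ σ)) -
            (-h (x, q) + inner ℝ q (gradP h (ζ σ))) -
            η * (inner ℝ (ζ σ).2 (0 : E) + inner ℝ (-gradX h (ζ σ)) e)
            = -(h (x + η • e, q') - h (x, q) - (inner ℝ (gradX h (x, q)) (η • e) +
                inner ℝ (gradP h (x, q)) (q' - q)))
              - inner ℝ (gradX h (x, q) - gradX h (ζ σ)) (η • e)
              - inner ℝ (gradP h (x, q) - gradP h (ζ σ)) (q' - q) := by
          simp only [inner_sub_left, inner_sub_right, inner_neg_left, inner_smul_right,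
            inner_zero_right]
          rw [real_inner_comm (gradP h (ζ σ)) q', real_inner_comm (gradP h (ζ σ)) q]
          ring
        rw [e1, Real.norm_eq_abs]
        refine (abs_sub _ _).trans ?_
        refine (add_le_add_left (abs_sub _ _) _).trans ?_
        rw [abs_neg]
        calc _ ≤ K * ((1 + Λ) * η) ^ 2 + K * m * η + K * m * (Λ * η) :=
              add_le_add (add_le_add (hT.trans hmax2) hi1) hi2
          _ = _ := by ring
    have hD := (hderiv b (hmem b (right_mem_Icc.2 hab))).sub
      (hderiv a (hmem a (left_mem_Icc.2 hab)))
    rw [← inner_sub_left] at hD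
    exact norm_le_of_hasDerivAt_of_le hD (by simp [hf0]) hbound
  rcases eq_or_ne (w b - w a) 0 with h0 | h0
  · rw [h0, norm_zero]
    exact mul_nonneg (by positivity) (sub_nonneg.2 hab)
  · have h1 := key (‖w b - w a‖⁻¹ • (w b - w a)) (by
      rw [norm_smul, norm_inv, norm_norm, inv_mul_cancel₀ (norm_ne_zero_iff.2 h0)])
    rwa [inner_smul_right, real_inner_self_eq_norm_sq, sq, inv_mul_cancel_left₀ (by simpa using h0),
      abs_norm] at h1

/-- A `C^{1,1}` solution is given by the characteristics. -/
theorem exists_eq_characValue [ProperSpace E] (hh : Differentiable ℝ h)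
    (hK : LipschitzWith K (fderiv ℝ h)) (hΦ : IsFlow (hamField h) Φ)
    (hv : ∀ q ∈ Icc 0 T ×ˢ univ, HasFDerivWithinAt v (solDiff h (q.2, p q)) (Icc 0 T ×ˢ univ) q)
    (hp : LocallyLipschitzOn (Icc 0 T ×ˢ univ) p) (hv0 : ∀ x, v (0, x) = g x)
    {s : ℝ} (hs : s ∈ Icc 0 T) (x : E) :
    ∃ y, (charac g Φ s y).1 = x ∧ v (s, x) = characValue h g Φ s y := by
  have hF := lipschitzWith_hamField hK
  -- The phase point (x, p (s, x)) is flowed back to time 0. Transport of the gradient puts it on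
  -- the graph of ∇g, so the trajectory is the characteristic issued from y.
  let y := (Φ (-s) (x, p (s, x))).1
  have hflow : ∀ σ, Φ (σ - s) (x, p (s, x)) = Φ σ (Φ (-s) (x, p (s, x))) := fun σ => by
    rw [sub_eq_add_neg, hΦ.add_apply hF]
  have hback : Φ s (Φ (-s) (x, p (s, x))) = (x, p (s, x)) := by
    rw [← hflow, sub_self, hΦ.zero]
  have hgrad := gradient_eq_along_flow hh hK hv hp hs.2
    (ζ := fun σ => Φ σ (Φ (-s) (x, p (s, x)))) (fun σ => hΦ.hasDerivAt σ _) (by simp [hback])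
  have hp0 : gradient g y = p (0, y) := by
    have h1 := (hv (0, y) ⟨⟨le_rfl, hs.1.trans hs.2⟩, mem_univ _⟩).comp (s := univ) y
      ((hasFDerivAt_prodMk_right (𝕜 := ℝ) (0 : ℝ) y).hasFDerivWithinAt)
      (fun r _ => ⟨⟨le_rfl, hs.1.trans hs.2⟩, mem_univ _⟩)
    rw [hasFDerivWithinAt_univ] at h1
    have h2 : HasFDerivAt g _ y := h1.congr_of_eventuallyEq (Eventually.of_forall fun r => by
      simp [hv0])
    refine ext_inner_right ℝ fun a => ?_
    rw [inner_gradient_eq_fderiv, h2.fderiv]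
    simp [solDiff]
  have hy : (y, gradient g y) = Φ (-s) (x, p (s, x)) := by
    have h1 := hgrad 0 ⟨le_rfl, hs.1⟩
    simp only [hΦ.zero] at h1
    rw [hp0]
    exact Prod.ext rfl h1
  have hchar : ∀ σ, charac g Φ σ y = Φ σ (Φ (-s) (x, p (s, x))) := fun σ => by
    rw [charac, hy]
  refine ⟨y, by rw [hchar, hback], ?_⟩
  have hd : ∀ σ ∈ Icc 0 s, HasDerivWithinAt
      (fun σ => v (σ, (charac g Φ σ y).1) - characValue h g Φ σ y) 0 (Icc 0 s) σ := by
    intro σ hσ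
    have h1 := (hasDerivWithinAt_solution_along hs.2 hv hσ
      (hΦ.hasDerivAt_fst σ (y, gradient g y))).sub
      (hasDerivAt_characValue (g := g) hh hK hΦ σ y).hasDerivWithinAt
    refine h1.congr_deriv ?_
    have h2 := hgrad σ hσ
    rw [← hchar] at h2
    change -h ((charac g Φ σ y).1, p (σ, (charac g Φ σ y).1)) +
      inner ℝ (p (σ, (charac g Φ σ y).1)) (gradP h (charac g Φ σ y)) - _ = 0
    rw [h2, Prod.mk.eta, real_inner_comm]
    ring
  have := (convex_Icc 0 s).norm_image_sub_le_of_norm_hasDerivWithin_le (C := 0) hd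
    (fun σ _ => by simp) (left_mem_Icc.2 hs.1) (right_mem_Icc.2 hs.1)
  rw [zero_mul, norm_le_zero_iff] at this
  have e0 : (charac g Φ 0 y).1 = y := by simp [charac, hΦ.zero]
  have e1 : (charac g Φ s y).1 = x := by rw [hchar, hback]
  simp only [e0, e1, hv0, characValue, intervalIntegral.integral_same, add_zero, sub_self,
    sub_zero] at this
  exact sub_eq_zero.1 this

end Uniqueness

/-! ### Extreme eigenvalues and quadratic forms -/

section Spectral

variable {d : ℕ}

theorem forall_spectrum_ge_iff {A : Matrix (Fin d) (Fin d) ℝ} (hA : A.IsHermitian) (c : ℝ) :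
    (∀ μ ∈ spectrum ℝ A, c ≤ μ) ↔
      ∀ x : Eu d, c * ‖x‖ ^ 2 ≤ inner ℝ x (Matrix.toEuclideanCLM (n := Fin d) (𝕜 := ℝ) A x) := by
  have hB : (A - algebraMap ℝ (Matrix (Fin d) (Fin d) ℝ) c).IsHermitian := by
    refine hA.sub ?_
    rw [Algebra.algebraMap_eq_smul_one]
    simp [Matrix.IsHermitian]
  have h1 : (∀ μ ∈ spectrum ℝ A, c ≤ μ) ↔
      (A - algebraMap ℝ (Matrix (Fin d) (Fin d) ℝ) c).PosSemidef := by
    rw [Matrix.posSemidef_iff_isHermitian_and_spectrum_nonneg, ← spectrum.sub_singleton_eq]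
    simp only [hB, true_and, Set.sub_singleton, image_subset_iff]
    exact forall₂_congr fun μ _ => by simp
  have h2 : ∀ x : Eu d, inner ℝ x (Matrix.toEuclideanCLM (n := Fin d) (𝕜 := ℝ) A x) - c * ‖x‖ ^ 2
      = star x.ofLp ⬝ᵥ
        (A - algebraMap ℝ (Matrix (Fin d) (Fin d) ℝ) c).mulVec x.ofLp := by
    intro x
    rw [Matrix.inner_toEuclideanCLM, Matrix.sub_mulVec, dotProduct_sub,
      Algebra.algebraMap_eq_smul_one, Matrix.smul_mulVec, Matrix.one_mulVec, dotProduct_smul,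
      EuclideanSpace.real_norm_sq_eq]
    simp [dotProduct, sq]
  rw [h1]
  constructor
  · intro h x
    have := h.dotProduct_mulVec_nonneg x.ofLp
    rw [← h2] at this
    linarith
  · intro h
    refine Matrix.PosSemidef.of_dotProduct_mulVec_nonneg hB fun x => ?_
    have h3 := h2 (WithLp.toLp 2 x)
    rw [← h3]
    linarith [h (WithLp.toLp 2 x)]

theorem lambdaMin_mul_sq_le {A : Matrix (Fin d) (Fin d) ℝ} (hA : A.IsHermitian) (x : Eu d) :
    lambdaMin A * ‖x‖ ^ 2 ≤ inner ℝ x (Matrix.toEuclideanCLM (n := Fin d) (𝕜 := ℝ) A x) :=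
  (forall_spectrum_ge_iff hA _).1
    (fun _ hμ => csInf_le A.finite_real_spectrum.bddBelow hμ) x

/-- Positive dimension makes the spectrum nonempty; for d = 0 the infimum would be the default value
0. -/
theorem le_lambdaMin (hd : 1 ≤ d) {A : Matrix (Fin d) (Fin d) ℝ} (hA : A.IsHermitian) {c : ℝ}
    (hc : ∀ x : Eu d,
      c * ‖x‖ ^ 2 ≤ inner ℝ x (Matrix.toEuclideanCLM (n := Fin d) (𝕜 := ℝ) A x)) :
    c ≤ lambdaMin A :=
  le_csInf ⟨_, hA.eigenvalues_mem_spectrum_real ⟨0, hd⟩⟩ ((forall_spectrum_ge_iff hA c).2 hc)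

theorem lambdaMax_eq_neg_lambdaMin_neg (A : Matrix (Fin d) (Fin d) ℝ) :
    lambdaMax A = -lambdaMin (-A) := by
  rw [lambdaMax, lambdaMin, Real.sInf_def, ← spectrum.neg_eq, neg_neg, neg_neg]

theorem toEuclideanCLM_neg_apply (A : Matrix (Fin d) (Fin d) ℝ) (x : Eu d) :
    inner ℝ x (Matrix.toEuclideanCLM (n := Fin d) (𝕜 := ℝ) (-A) x) =
      -inner ℝ x (Matrix.toEuclideanCLM (n := Fin d) (𝕜 := ℝ) A x) := by
  simp

theorem le_lambdaMax_mul_sq {A : Matrix (Fin d) (Fin d) ℝ} (hA : A.IsHermitian) (x : Eu d) :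
    inner ℝ x (Matrix.toEuclideanCLM (n := Fin d) (𝕜 := ℝ) A x) ≤ lambdaMax A * ‖x‖ ^ 2 := by
  have := lambdaMin_mul_sq_le hA.neg x
  rw [toEuclideanCLM_neg_apply] at this
  rw [lambdaMax_eq_neg_lambdaMin_neg]
  linarith

theorem lambdaMax_le (hd : 1 ≤ d) {A : Matrix (Fin d) (Fin d) ℝ} (hA : A.IsHermitian) {c : ℝ}
    (hc : ∀ x : Eu d,
      inner ℝ x (Matrix.toEuclideanCLM (n := Fin d) (𝕜 := ℝ) A x) ≤ c * ‖x‖ ^ 2) :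
    lambdaMax A ≤ c := by
  rw [lambdaMax_eq_neg_lambdaMin_neg]
  have := le_lambdaMin (c := -c) hd hA.neg fun x => by
    rw [toEuclideanCLM_neg_apply]
    linarith [hc x]
  linarith

theorem sum_smul_basisVec (x : Eu d) : ∑ i, x i • basisVec i = x := by
  ext j
  simp [basisVec, Pi.single_apply]

theorem inner_toEuclideanCLM_of_bilin (B : Eu d →ₗ[ℝ] Eu d →ₗ[ℝ] ℝ) (x y : Eu d) :
    inner ℝ x (Matrix.toEuclideanCLM (n := Fin d) (𝕜 := ℝ)
      (Matrix.of fun i j => B (basisVec i) (basisVec j)) y) = B x y := by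
  rw [Matrix.inner_toEuclideanCLM]
  conv_rhs => rw [← sum_smul_basisVec x, ← sum_smul_basisVec y]
  simp only [map_sum, map_smul, LinearMap.sum_apply, LinearMap.smul_apply, smul_eq_mul,
    dotProduct, Matrix.mulVec, Matrix.of_apply]
  simp only [Finset.mul_sum]
  rw [Finset.sum_comm]
  refine Finset.sum_congr rfl fun i _ => ?_
  refine Finset.sum_congr rfl fun j _ => ?_
  ring

end Spectral

theorem exists_lipschitzWith_fderiv {W : Type*} [NormedAddCommGroup W] [NormedSpace ℝ W]
    {f : W → ℝ} (hf : ContDiff ℝ 2 f) (hf2 : BoundedSecondDeriv f) :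
    ∃ K : ℝ≥0, LipschitzWith K (fderiv ℝ f) := by
  obtain ⟨C, hC⟩ := hf2
  refine ⟨C.toNNReal, lipschitzWith_of_nnnorm_fderiv_le
    ((hf.fderiv_right (m := 1) (by norm_num)).differentiable one_ne_zero) fun z => ?_⟩
  rw [← NNReal.coe_le_coe]
  exact (hC z).trans (Real.le_coe_toNNReal C)

/-! ### Quadratic form bounds from the spectral constants -/

section QuadraticBounds

variable {d : ℕ} {H : Eu d → Eu d → ℝ} {G : Eu d → ℝ}

/-- The block of a bilinear form on a product, between the ranges of two linear maps. -/
def bilinBlock {V W : Type*} [AddCommGroup V] [Module ℝ V] [NormedAddCommGroup W] [NormedSpace ℝ W]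
    (B : W →L[ℝ] W →L[ℝ] ℝ) (i j : V →ₗ[ℝ] W) : V →ₗ[ℝ] V →ₗ[ℝ] ℝ :=
  LinearMap.mk₂ ℝ (fun x y => B (i x) (j y)) (by simp) (by simp) (by simp) (by simp)

theorem inner_dxx (a b x y : Eu d) :
    inner ℝ x (Matrix.toEuclideanCLM (n := Fin d) (𝕜 := ℝ) (dxx H a b) y) =
      D2 H a b (x, 0) (y, 0) :=
  inner_toEuclideanCLM_of_bilin
    (bilinBlock (D2 H a b) (LinearMap.inl ℝ (Eu d) (Eu d)) (LinearMap.inl ℝ (Eu d) (Eu d))) x y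

theorem inner_dxp (a b x y : Eu d) :
    inner ℝ x (Matrix.toEuclideanCLM (n := Fin d) (𝕜 := ℝ) (dxp H a b) y) =
      D2 H a b (x, 0) (0, y) :=
  inner_toEuclideanCLM_of_bilin
    (bilinBlock (D2 H a b) (LinearMap.inl ℝ (Eu d) (Eu d)) (LinearMap.inr ℝ (Eu d) (Eu d))) x y

theorem inner_dpp (a b x y : Eu d) :
    inner ℝ x (Matrix.toEuclideanCLM (n := Fin d) (𝕜 := ℝ) (dpp H a b) y) =
      D2 H a b (0, x) (0, y) :=
  inner_toEuclideanCLM_of_bilin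
    (bilinBlock (D2 H a b) (LinearMap.inr ℝ (Eu d) (Eu d)) (LinearMap.inr ℝ (Eu d) (Eu d))) x y

theorem inner_hess (a x y : Eu d) :
    inner ℝ x (Matrix.toEuclideanCLM (n := Fin d) (𝕜 := ℝ) (hess G a) y) =
      fderiv ℝ (fderiv ℝ G) a x y :=
  inner_toEuclideanCLM_of_bilin
    (bilinBlock (fderiv ℝ (fderiv ℝ G) a) LinearMap.id LinearMap.id) x y

theorem inner_symPart (A : Matrix (Fin d) (Fin d) ℝ) (x : Eu d) :
    inner ℝ x (Matrix.toEuclideanCLM (n := Fin d) (𝕜 := ℝ) (symPart A) x) =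
      inner ℝ x (Matrix.toEuclideanCLM (n := Fin d) (𝕜 := ℝ) A x) := by
  simp only [Matrix.inner_toEuclideanCLM, symPart, Matrix.smul_mulVec, Matrix.add_mulVec,
    dotProduct_smul, dotProduct_add, Matrix.mulVec_transpose]
  rw [dotProduct_comm x.ofLp (Matrix.vecMul _ _), ← Matrix.dotProduct_mulVec, smul_eq_mul]
  ring

theorem isHermitian_symPart (A : Matrix (Fin d) (Fin d) ℝ) : (symPart A).IsHermitian := by
  ext i j
  simp only [symPart, Matrix.conjTranspose_apply, Matrix.smul_apply, Matrix.add_apply,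
    Matrix.transpose_apply, star_trivial, add_comm]

theorem snd_fderiv_comm {W : Type*} [NormedAddCommGroup W] [NormedSpace ℝ W] {f : W → ℝ}
    (hf : ContDiff ℝ 2 f) (z u v : W) :
    fderiv ℝ (fderiv ℝ f) z u v = fderiv ℝ (fderiv ℝ f) z v u :=
  (hf.contDiffAt.isSymmSndFDerivAt (by simp)) u v

theorem isHermitian_dxx (hH : ContDiff ℝ 2 (Function.uncurry H)) (a b : Eu d) :
    (dxx H a b).IsHermitian := by
  ext i j
  exact snd_fderiv_comm hH _ _ _

theorem isHermitian_hess (hG : ContDiff ℝ 2 G) (a : Eu d) : (hess G a).IsHermitian := by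
  ext i j
  exact snd_fderiv_comm hG _ _ _

theorem abs_bilin_le {W : Type*} [NormedAddCommGroup W] [NormedSpace ℝ W]
    {B : W →L[ℝ] W →L[ℝ] ℝ} {C : ℝ} (hC : ‖B‖ ≤ C) (u v : W) : |B u v| ≤ C * ‖u‖ * ‖v‖ :=
  (B.le_opNorm₂ u v).trans (by gcongr)

/-- The bound on the second derivative ensures that the infimum over (x, p) is a genuine lower bound
and not the default value of an unbounded family. -/
theorem lambdaZero_mul_sq_le (hd : 1 ≤ d) (hH2 : BoundedSecondDeriv (Function.uncurry H))
    (a b x : Eu d) : lambdaZero H * ‖x‖ ^ 2 ≤ D2 H a b (x, 0) (0, x) := by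
  obtain ⟨C, hC⟩ := hH2
  have hbdd : BddBelow (range fun z : Eu d × Eu d => lambdaMin (symPart (dxp H z.1 z.2))) := by
    refine ⟨-C, ?_⟩
    rintro _ ⟨z, rfl⟩
    refine le_lambdaMin hd (isHermitian_symPart _) fun x => ?_
    rw [inner_symPart, inner_dxp]
    have h1 := neg_le_of_abs_le (abs_bilin_le (hC z) (x, 0) (0, x))
    simp only [Prod.norm_mk, norm_zero, norm_nonneg, sup_of_le_left, sup_of_le_right] at h1
    calc _ = -(C * ‖x‖ * ‖x‖) := by ring
      _ ≤ _ := h1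
  have h1 : lambdaZero H ≤ lambdaMin (symPart (dxp H a b)) := ciInf_le hbdd (a, b)
  have h2 := lambdaMin_mul_sq_le (isHermitian_symPart (dxp H a b)) x
  rw [inner_symPart, inner_dxp] at h2
  exact (mul_le_mul_of_nonneg_right h1 (sq_nonneg _)).trans h2

theorem le_lambdaH_mul_sq (hd : 1 ≤ d) (hH : ContDiff ℝ 2 (Function.uncurry H))
    (hH2 : BoundedSecondDeriv (Function.uncurry H)) (a b x : Eu d) :
    D2 H a b (x, 0) (x, 0) ≤ lambdaH H * ‖x‖ ^ 2 := by
  obtain ⟨C, hC⟩ := hH2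
  have hbdd : BddAbove (range fun z : Eu d × Eu d => lambdaMax (dxx H z.1 z.2)) := by
    refine ⟨C, ?_⟩
    rintro _ ⟨z, rfl⟩
    refine lambdaMax_le hd (isHermitian_dxx hH _ _) fun x => ?_
    rw [inner_dxx]
    have h1 := le_of_abs_le (abs_bilin_le (hC z) (x, 0) (x, 0))
    simp only [Prod.norm_mk, norm_zero, norm_nonneg, sup_of_le_left] at h1
    calc _ ≤ _ := h1
      _ = _ := by ring
  have h1 : lambdaMax (dxx H a b) ≤ lambdaH H := le_ciSup hbdd (a, b)
  have h2 := le_lambdaMax_mul_sq (isHermitian_dxx hH a b) x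
  rw [inner_dxx] at h2
  exact h2.trans (mul_le_mul_of_nonneg_right h1 (sq_nonneg _))

theorem le_normDpp_mul_sq (hH2 : BoundedSecondDeriv (Function.uncurry H)) (a b x : Eu d) :
    D2 H a b (0, x) (0, x) ≤ normDpp H * ‖x‖ ^ 2 := by
  obtain ⟨C, hC⟩ := hH2
  have hC0 : 0 ≤ C := (ContinuousLinearMap.opNorm_nonneg _).trans (hC (a, b))
  have hbdd : BddAbove (range fun z : Eu d × Eu d =>
      ‖Matrix.toEuclideanCLM (n := Fin d) (𝕜 := ℝ) (dpp H z.1 z.2)‖) := by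
    refine ⟨C, ?_⟩
    rintro _ ⟨z, rfl⟩
    refine ContinuousLinearMap.opNorm_le_bound _ hC0 fun y => ?_
    -- Testing the bilinear form against w, the image of y, gives ‖w‖² ≤ C ‖w‖ ‖y‖.
    set w := Matrix.toEuclideanCLM (n := Fin d) (𝕜 := ℝ) (dpp H z.1 z.2) y with hw
    have h1 := le_of_abs_le (abs_bilin_le (hC z) ((0 : Eu d), w) ((0 : Eu d), y))
    have h2 : fderiv ℝ (fderiv ℝ (Function.uncurry H)) z ((0 : Eu d), w) ((0 : Eu d), y) =
        ‖w‖ * ‖w‖ := by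
      rw [← real_inner_self_eq_norm_mul_norm]
      exact (inner_dpp z.1 z.2 w y).symm
    rw [h2] at h1
    simp only [Prod.norm_mk, norm_zero, norm_nonneg, sup_of_le_right] at h1
    rcases (norm_nonneg w).eq_or_lt with h0 | h0
    · rw [← h0]; positivity
    · exact le_of_mul_le_mul_right (by linarith) h0
  have h1 : ‖Matrix.toEuclideanCLM (n := Fin d) (𝕜 := ℝ) (dpp H a b)‖ ≤ normDpp H :=
    le_ciSup hbdd (a, b)
  rw [← inner_dpp]
  refine (real_inner_le_norm _ _).trans ?_
  have h2 := (Matrix.toEuclideanCLM (n := Fin d) (𝕜 := ℝ) (dpp H a b)).le_opNorm x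
  nlinarith [norm_nonneg x, mul_le_mul_of_nonneg_right h1 (norm_nonneg x)]

theorem normDpp_nonneg (H : Eu d → Eu d → ℝ) : 0 ≤ normDpp H :=
  Real.iSup_nonneg fun _ => norm_nonneg _

theorem lambdaG_mul_sq_le (hd : 1 ≤ d) (hG : ContDiff ℝ 2 G) (hG2 : BoundedSecondDeriv G)
    (a x : Eu d) : lambdaG G * ‖x‖ ^ 2 ≤ fderiv ℝ (fderiv ℝ G) a x x := by
  obtain ⟨C, hC⟩ := hG2
  have hbdd : BddBelow (range fun a : Eu d => lambdaMin (hess G a)) := by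
    refine ⟨-C, ?_⟩
    rintro _ ⟨z, rfl⟩
    refine le_lambdaMin hd (isHermitian_hess hG _) fun x => ?_
    rw [inner_hess]
    have h1 := neg_le_of_abs_le (abs_bilin_le (hC z) x x)
    calc _ = -(C * ‖x‖ * ‖x‖) := by ring
      _ ≤ _ := h1
  have h1 : lambdaG G ≤ lambdaMin (hess G a) := ciInf_le hbdd a
  have h2 := lambdaMin_mul_sq_le (isHermitian_hess hG a) x
  rw [inner_hess] at h2
  exact (mul_le_mul_of_nonneg_right h1 (sq_nonneg _)).trans h2

/-- Restricted to a line in p, the convex function has a monotone derivative, whose own derivative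
at 0 is the quadratic form. -/
theorem D2_snd_nonneg (hH : ContDiff ℝ 2 (Function.uncurry H))
    (hconv : ∀ x, ConvexOn ℝ univ (H x)) (a b x : Eu d) : 0 ≤ D2 H a b (0, x) (0, x) := by
  have hd1 : Differentiable ℝ (Function.uncurry H) := hH.differentiable (by norm_num)
  have hd2 : Differentiable ℝ (fderiv ℝ (Function.uncurry H)) :=
    (hH.fderiv_right (m := 1) (by norm_num)).differentiable (by norm_num)
  have hline : ∀ τ : ℝ, HasDerivAt (fun τ : ℝ => (a, b + τ • x)) ((0 : Eu d), x) τ := fun τ => by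
    simpa using (hasDerivAt_const τ a).prodMk (((hasDerivAt_id τ).smul_const x).const_add b)
  have h1 : ∀ τ : ℝ, HasDerivAt (fun τ : ℝ => H a (b + τ • x))
      (fderiv ℝ (Function.uncurry H) (a, b + τ • x) (0, x)) τ := fun τ =>
    HasFDerivAt.comp_hasDerivAt (f := fun τ : ℝ => (a, b + τ • x)) τ
      (hd1 (a, b + τ • x)).hasFDerivAt (hline τ)
  have h2 : HasDerivAt (fun τ : ℝ => fderiv ℝ (Function.uncurry H) (a, b + τ • x) (0, x))
      (D2 H a b (0, x) (0, x)) 0 := by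
    have h3 := (hd2 (a, b + (0 : ℝ) • x)).hasFDerivAt.comp_hasDerivAt 0 (hline 0)
    have h4 := h3.clm_apply (hasDerivAt_const (0 : ℝ) ((0 : Eu d), x))
    simpa [D2] using h4
  have hc : ConvexOn ℝ univ fun τ : ℝ => H a (b + τ • x) := by
    have := (hconv a).comp_affineMap (AffineMap.lineMap b (b + x) : ℝ →ᵃ[ℝ] Eu d)
    simpa [Function.comp_def, AffineMap.lineMap_apply, add_comm] using this
  have hm : Monotone (deriv fun τ : ℝ => H a (b + τ • x)) :=
    monotoneOn_univ.1 (hc.monotoneOn_deriv fun τ _ => (h1 τ).differentiableAt)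
  rw [show (deriv fun τ : ℝ => H a (b + τ • x)) =
    fun τ : ℝ => fderiv ℝ (Function.uncurry H) (a, b + τ • x) (0, x) from
    funext fun τ => (h1 τ).deriv] at hm
  rw [← h2.deriv]
  exact hm.deriv_nonneg

end QuadraticBounds

/-! ### Riccati subsolution and construction of the barrier -/

section Barrier

/-- A strict subsolution of the Riccati equation `k' = -(lH + 2 l₀ k + b k²)`. -/
theorem exists_riccati_subsolution {b l₀ lH lG : ℝ} (hb : 0 ≤ b) (hdisc : b * lH ≤ l₀ ^ 2)
    (hterm : 0 ≤ l₀ + √(l₀ ^ 2 - b * lH) + b * lG) (hsign : lH ≤ 0 ∨ 0 ≤ l₀) (T : ℝ) :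
    ∃ (k k' : ℝ → ℝ) (ε : ℝ), 0 < ε ∧ (∀ s, HasDerivAt k (k' s) s) ∧ k 0 + ε ≤ lG ∧
      ∀ s ∈ Icc 0 T, k s ≤ 0 ∧ k' s ≤ -(lH + 2 * l₀ * k s + b * k s ^ 2) := by
  have hexp : ∀ A c m s : ℝ, HasDerivAt (fun s => A - c * Real.exp (m * s))
      (-(m * (c * Real.exp (m * s)))) s := fun A c m s => by
    have h1 := ((((hasDerivAt_id s).const_mul m).exp).const_mul c).const_sub A
    refine h1.congr_deriv ?_
    simp only [id]
    ring
  rcases hb.eq_or_lt with rfl | hb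
  -- For b = 0 the inequality is linear. With k = -y and y ≥ 1, growth at rate |lH| + 2|l₀|
  -- dominates both lH and -2 l₀ y.
  · refine ⟨_, _, 1, one_pos, hexp 0 (1 + |lG|) (|lH| + 2 * |l₀|), ?_, fun s hs => ?_⟩
    · simp only [mul_zero, Real.exp_zero]
      linarith [neg_abs_le lG]
    · set y := (1 + |lG|) * Real.exp ((|lH| + 2 * |l₀|) * s) with hy
      have he : 1 ≤ Real.exp ((|lH| + 2 * |l₀|) * s) :=
        Real.one_le_exp (mul_nonneg (by positivity) hs.1)
      have hy1 : 1 ≤ y := by nlinarith [abs_nonneg lG]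
      refine ⟨by linarith, ?_⟩
      have h1 : lH ≤ |lH| * y := (le_abs_self lH).trans (le_mul_of_one_le_right (abs_nonneg _) hy1)
      have h2 : -l₀ * y ≤ |l₀| * y := mul_le_mul_of_nonneg_right (neg_le_abs l₀) (by linarith)
      nlinarith
  · set r := √(l₀ ^ 2 - b * lH) with hr
    have hr0 : 0 ≤ r := Real.sqrt_nonneg _
    have hr2 : r ^ 2 = l₀ ^ 2 - b * lH := Real.sq_sqrt (by linarith)
    -- The sign hypothesis makes the lower root k₀ = -(l₀ + r) / b nonpositive: if lH ≤ 0 then r² ≥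
    -- l₀².
    have hsum : 0 ≤ l₀ + r := by
      rcases hsign with h | h
      · have : -l₀ ≤ r := Real.le_sqrt_of_sq_le (by nlinarith)
        linarith
      · linarith
    set k₀ := -(l₀ + r) / b with hk₀
    have hbk : b * k₀ = -(l₀ + r) := by rw [hk₀]; field_simp
    have hk₀0 : k₀ ≤ 0 := div_nonpos_of_nonpos_of_nonneg (by linarith) hb.le
    have hroot : b * k₀ ^ 2 + 2 * l₀ * k₀ + lH = 0 := by
      have h1 : b * (b * k₀ ^ 2 + 2 * l₀ * k₀ + lH) = 0 := by
        have : b * (b * k₀ ^ 2 + 2 * l₀ * k₀ + lH) =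
          (b * k₀) ^ 2 + 2 * l₀ * (b * k₀) + b * lH := by ring
        rw [this, hbk]
        nlinarith
      exact (mul_eq_zero.1 h1).resolve_left hb.ne'
    -- The curve is k = k₀ - η with η growing at rate 2r + 1. At k₀ - η the quadratic equals 2rη +
    -- bη², so that rate suffices while b η ≤ 1; the size of ε keeps this true up to time T. Since k
    -- 0 + ε = k₀, the case k₀ = lG is allowed.
    refine ⟨_, _, Real.exp (-((2 * r + 1) * T)) / (b + 1), by positivity,
      hexp k₀ (Real.exp (-((2 * r + 1) * T)) / (b + 1)) (2 * r + 1), ?_, fun s hs => ?_⟩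
    · simp only [mul_zero, Real.exp_zero, mul_one, sub_add_cancel]
      rw [hk₀, div_le_iff₀ hb]
      linarith
    · set η := Real.exp (-((2 * r + 1) * T)) / (b + 1) * Real.exp ((2 * r + 1) * s) with hη
      have hη0 : 0 ≤ η := by positivity
      have hbη : b * η ≤ 1 := by
        have h1 : Real.exp (-((2 * r + 1) * T)) * Real.exp ((2 * r + 1) * s) ≤ 1 := by
          rw [← Real.exp_add, Real.exp_le_one_iff]
          have := mul_le_mul_of_nonneg_left hs.2 (show 0 ≤ 2 * r + 1 by linarith)
          linarith
        have h2 : η = Real.exp (-((2 * r + 1) * T)) * Real.exp ((2 * r + 1) * s) / (b + 1) := by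
          rw [hη]; ring
        rw [h2, ← mul_div_assoc, div_le_one (by linarith)]
        nlinarith
      refine ⟨by linarith, ?_⟩
      have h3 : lH + 2 * l₀ * (k₀ - η) + b * (k₀ - η) ^ 2 = 2 * r * η + (b * η) * η := by
        have : lH + 2 * l₀ * (k₀ - η) + b * (k₀ - η) ^ 2 =
          (b * k₀ ^ 2 + 2 * l₀ * k₀ + lH) - 2 * l₀ * η - 2 * (b * k₀) * η + (b * η) * η := by ring
        rw [this, hroot, hbk]
        ring
      rw [h3]
      nlinarith

/-- The direction u is fixed, so the scalar mean value theorem applies and a single intermediate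
point serves all blocks of the second derivative at once. -/
theorem exists_fderiv_sub_eq {W : Type*} [NormedAddCommGroup W] [NormedSpace ℝ W] {f : W → ℝ}
    (hf : ContDiff ℝ 2 f) (z w u : W) :
    ∃ ζ, fderiv ℝ f z u - fderiv ℝ f w u = fderiv ℝ (fderiv ℝ f) ζ (z - w) u := by
  have hd2 : Differentiable ℝ (fderiv ℝ f) :=
    (hf.fderiv_right (m := 1) (by norm_num)).differentiable (by norm_num)
  have hline : ∀ τ : ℝ, HasDerivAt (fun τ : ℝ => w + τ • (z - w)) (z - w) τ := fun τ => by
    simpa using ((hasDerivAt_id τ).smul_const (z - w)).const_add w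
  have h1 : ∀ τ : ℝ, HasDerivAt (fun τ : ℝ => fderiv ℝ f (w + τ • (z - w)) u)
      (fderiv ℝ (fderiv ℝ f) (w + τ • (z - w)) (z - w) u) τ := fun τ => by
    have h3 := (hd2 (w + τ • (z - w))).hasFDerivAt.comp_hasDerivAt τ (hline τ)
    simpa using h3.clm_apply (hasDerivAt_const τ u)
  obtain ⟨τ, -, hτ⟩ := exists_hasDerivAt_eq_slope _ _ (zero_lt_one' ℝ)
    (fun τ _ => (h1 τ).continuousAt.continuousWithinAt) (fun τ _ => h1 τ)
  exact ⟨_, by simpa using hτ.symm⟩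

theorem exists_isBarrier {d : ℕ} (hd : 1 ≤ d) {H : Eu d → Eu d → ℝ} {G : Eu d → ℝ}
    (hH : ContDiff ℝ 2 (Function.uncurry H)) (hG : ContDiff ℝ 2 G)
    (hH2 : BoundedSecondDeriv (Function.uncurry H)) (hG2 : BoundedSecondDeriv G)
    (hconv : ∀ x, ConvexOn ℝ univ (H x))
    (hdisc : normDpp H * lambdaH H ≤ lambdaZero H ^ 2)
    (hterm : 0 ≤ lambdaZero H + √(lambdaZero H ^ 2 - normDpp H * lambdaH H)
      + normDpp H * lambdaG G)
    (hsign : lambdaH H ≤ 0 ∨ 0 ≤ lambdaZero H) (T : ℝ) :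
    ∃ k k' ε, IsBarrier (Function.uncurry H) G T k k' ε := by
  obtain ⟨k, k', ε, hε, hk, hk0, hric⟩ :=
    exists_riccati_subsolution (normDpp_nonneg H) hdisc hterm hsign T
  refine ⟨k, k', ε, hε, hk, fun s hs z w => ?_, fun y y' => ?_⟩
  · obtain ⟨hks, hks'⟩ := hric s hs
    set X := z.1 - w.1 with hX
    set P := z.2 - w.2 with hP
    -- The direction is the one for which the two inner products of the barrier inequality combine
    -- into one increment of the derivative of H.
    obtain ⟨⟨a, b⟩, hζ⟩ := exists_fderiv_sub_eq hH z w (-X, P - (2 * k s) • X)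
    have hzw : z - w = (X, 0) + (0, P) := by simp [hX, hP, Prod.ext_iff]
    have hu : (-X, P - (2 * k s) • X) = -(X, 0) + (0, P) - (2 * k s) • ((0 : Eu d), X) := by
      simp
    have hv : ((0 : Eu d), P - k s • X) = (0, P) - k s • ((0 : Eu d), X) := by simp
    have hlhs : -inner ℝ (gradX (Function.uncurry H) z - gradX (Function.uncurry H) w) X +
        inner ℝ (gradP (Function.uncurry H) z - gradP (Function.uncurry H) w) (P - (2 * k s) • X)
        = D2 H a b ((X, 0) + (0, P)) (-(X, 0) + (0, P) - (2 * k s) • ((0 : Eu d), X)) := by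
      rw [← hzw, ← hu]
      refine Eq.trans ?_ hζ
      rw [fderiv_eq_inner_add_inner, fderiv_eq_inner_add_inner]
      simp only [inner_sub_left, inner_neg_right]
      ring
    rw [hlhs]
    have h1 := lambdaZero_mul_sq_le hd hH2 a b X
    have h2 := le_lambdaH_mul_sq hd hH hH2 a b X
    have h3 := le_normDpp_mul_sq hH2 a b X
    -- The mixed terms in X and P cancel by symmetry. Completing the square leaves -∂_xx(X, X) - 2k
    -- ∂_xp(X, X) - k² ∂_pp(X, X) + ∂_pp(P - kX, P - kX), and convexity discards the last term.
    have h4 := D2_snd_nonneg hH hconv a b (P - k s • X)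
    have hsym1 : D2 H a b (0, P) (X, 0) = D2 H a b (X, 0) (0, P) := snd_fderiv_comm hH _ _ _
    have hsym2 : D2 H a b (0, X) (0, P) = D2 H a b (0, P) (0, X) := snd_fderiv_comm hH _ _ _
    rw [hv] at h4
    simp only [map_add, map_sub, map_neg, map_smul, add_apply, sub_apply, smul_apply, smul_eq_mul] at h4 ⊢
    rw [hsym2] at h4
    rw [hsym1]
    -- Here k ≤ 0 is essential: the mixed block is bounded only from below.
    have h5 := mul_le_mul_of_nonneg_left h1 (show 0 ≤ -(2 * k s) by linarith)
    have h6 := mul_le_mul_of_nonneg_left h3 (sq_nonneg (k s))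
    have h7 := mul_le_mul_of_nonneg_right hks' (sq_nonneg ‖X‖)
    linarith
  · obtain ⟨ζ, hζ⟩ := exists_fderiv_sub_eq hG y y' (y - y')
    rw [inner_sub_left, inner_gradient_eq_fderiv, inner_gradient_eq_fderiv, hζ]
    exact (mul_le_mul_of_nonneg_right hk0 (sq_nonneg _)).trans (lambdaG_mul_sq_le hd hG hG2 ζ _)

end Barrier

/-! ### Time reversal on the strip -/

section TimeReversal

variable {d : ℕ} {T : ℝ}

/-- Reversal of the time direction on tangent vectors. -/
def revCLM (d : ℕ) : ℝ × Eu d →L[ℝ] ℝ × Eu d :=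
  (-ContinuousLinearMap.fst ℝ ℝ (Eu d)).prod (ContinuousLinearMap.snd ℝ ℝ (Eu d))

/-- Time reversal `(t, x) ↦ (T - t, x)`. -/
def timeRev (T : ℝ) (q : ℝ × Eu d) : ℝ × Eu d := (T - q.1, q.2)

theorem timeRev_timeRev (q : ℝ × Eu d) : timeRev T (timeRev T q) = q := by
  simp [timeRev]

theorem mapsTo_timeRev : MapsTo (timeRev T) (strip d T) (strip d T) := by
  rintro ⟨t, x⟩ ⟨ht, -⟩
  exact ⟨⟨by simpa [timeRev] using ht.2, by simpa [timeRev] using ht.1⟩, mem_univ _⟩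

theorem hasFDerivAt_timeRev (q : ℝ × Eu d) : HasFDerivAt (timeRev T) (revCLM d) q :=
  (hasFDerivAt_fst.const_sub T).prodMk hasFDerivAt_snd

theorem contDiff_timeRev : ContDiff ℝ 1 (timeRev (d := d) T) :=
  (contDiff_const.sub contDiff_fst).prodMk contDiff_snd

theorem locallyLipschitzOn_timeRev : LocallyLipschitzOn (strip d T) (timeRev T) :=
  contDiff_timeRev.locallyLipschitz.locallyLipschitzOn

theorem hasFDerivWithinAt_comp_timeRev {u : ℝ × Eu d → ℝ} {D : ℝ × Eu d →L[ℝ] ℝ} {q : ℝ × Eu d}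
    (hu : HasFDerivWithinAt u D (strip d T) (timeRev T q)) :
    HasFDerivWithinAt (u ∘ timeRev T) (D.comp (revCLM d)) (strip d T) q :=
  hu.comp q (hasFDerivAt_timeRev q).hasFDerivWithinAt mapsTo_timeRev

theorem uniqueDiffOn_strip (hT : 0 < T) : UniqueDiffOn ℝ (strip d T) :=
  (uniqueDiffOn_Icc hT).prod uniqueDiffOn_univ

theorem strip_mem_nhds {t : ℝ} (ht : t ∈ Ioo 0 T) (x : Eu d) : strip d T ∈ 𝓝 (t, x) :=
  prod_mem_nhds (Icc_mem_nhds ht.1 ht.2) univ_mem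

end TimeReversal

/-! ### Terminal value problem versus forward problem -/

section Solutions

variable {d : ℕ} {T : ℝ}

theorem deriv_time_eq {u : ℝ × Eu d → ℝ} {D : ℝ × Eu d →L[ℝ] ℝ} {t : ℝ} {x : Eu d}
    (hu : HasFDerivAt u D (t, x)) : deriv (fun s => u (s, x)) t = D (1, 0) := by
  have h1 : HasDerivAt (fun s : ℝ => (s, x)) ((1 : ℝ), (0 : Eu d)) t :=
    (hasDerivAt_id t).prodMk (hasDerivAt_const t x)
  exact (HasFDerivAt.comp_hasDerivAt (f := fun s : ℝ => (s, x)) t hu h1).deriv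

theorem gradient_space_eq {u : ℝ × Eu d → ℝ} {D : ℝ × Eu d →L[ℝ] ℝ} {t : ℝ} {x : Eu d}
    (hu : HasFDerivAt u D (t, x)) : gradient (fun y => u (t, y)) x =
      (InnerProductSpace.toDual ℝ (Eu d)).symm (D.comp (ContinuousLinearMap.inr ℝ ℝ (Eu d))) := by
  have h1 : HasFDerivAt (fun y => u (t, y)) _ x :=
    HasFDerivAt.comp (f := fun y : Eu d => (t, y)) x hu (hasFDerivAt_prodMk_right t x)
  rw [gradient, h1.fderiv]

/-- A forward solution yields, by time reversal, a solution of the terminal value problem. -/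
theorem isC11Solution_comp_timeRev {H : Eu d → Eu d → ℝ} {G : Eu d → ℝ} (hT : 0 < T)
    (hH : ContDiff ℝ 2 (Function.uncurry H)) {v : ℝ × Eu d → ℝ} {p : ℝ × Eu d → Eu d}
    (hv : ∀ q ∈ strip d T,
      HasFDerivWithinAt v (solDiff (Function.uncurry H) (q.2, p q)) (strip d T) q)
    (hp : LocallyLipschitzOn (strip d T) p) (hv0 : ∀ x, v (0, x) = G x) :
    IsC11Solution H G T (v ∘ timeRev T) := by
  have hd : ∀ q ∈ strip d T, HasFDerivWithinAt (v ∘ timeRev T)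
      ((solDiff (Function.uncurry H) (q.2, p (timeRev T q))).comp (revCLM d)) (strip d T) q :=
    fun q hq => hasFDerivWithinAt_comp_timeRev (hv _ (mapsTo_timeRev hq))
  have hfd : ∀ q ∈ strip d T, fderivWithin ℝ (v ∘ timeRev T) (strip d T) q =
      (solDiff (Function.uncurry H) (q.2, p (timeRev T q))).comp (revCLM d) := fun q hq =>
    (hd q hq).fderivWithin (uniqueDiffOn_strip hT q hq)
  have hlip : LocallyLipschitzOn (strip d T) (fderivWithin ℝ (v ∘ timeRev T) (strip d T)) := by
    have hΨ : ContDiff ℝ 1 fun z : Eu d × Eu d =>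
        (solDiff (Function.uncurry H) z).comp (revCLM d) :=
      (contDiff_solDiff hH).clm_comp contDiff_const
    have hpair : LocallyLipschitzOn (strip d T) fun q : ℝ × Eu d => (q.2, p (timeRev T q)) := by
      intro q hq
      obtain ⟨K, U, hU, hK⟩ := locallyLipschitzOn_comp hp locallyLipschitzOn_timeRev
        mapsTo_timeRev hq
      exact ⟨max 1 K, U, hU, LipschitzWith.prod_snd.lipschitzOnWith.prodMk hK⟩
    have h1 := locallyLipschitzOn_comp hΨ.locallyLipschitz.locallyLipschitzOn hpair
      (mapsTo_univ _ _)
    intro q hq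
    obtain ⟨K, U, hU, hK⟩ := h1 hq
    refine ⟨K, U ∩ strip d T, inter_mem hU self_mem_nhdsWithin, fun a ha b hb => ?_⟩
    rw [hfd a ha.2, hfd b hb.2]
    exact hK ha.1 hb.1
  refine ⟨⟨?_, hlip⟩, fun t ht x => ?_, fun x => by simp [timeRev, hv0]⟩
  · rw [show (1 : WithTop ℕ∞) = 0 + 1 from rfl,
      contDiffOn_succ_iff_fderivWithin (uniqueDiffOn_strip hT)]
    refine ⟨fun q hq => (hd q hq).differentiableWithinAt, by simp, ?_⟩
    exact contDiffOn_zero.2 hlip.continuousOn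
  · have h1 := (hd (t, x) ⟨Ioo_subset_Icc_self ht, mem_univ _⟩).hasFDerivAt (strip_mem_nhds ht x)
    have hgrad : gradient (fun y => (v ∘ timeRev T) (t, y)) x = p (timeRev T (t, x)) := by
      rw [gradient_space_eq h1, LinearIsometryEquiv.symm_apply_eq]
      ext a
      simp [solDiff, revCLM]
    rw [deriv_time_eq h1, hgrad]
    simp [solDiff, revCLM]

/-- A solution of the terminal value problem satisfies the equation up to the boundary and yields,
by time reversal, a forward solution. -/
theorem exists_forward_of_isC11Solution {H : Eu d → Eu d → ℝ} {G : Eu d → ℝ} (hT : 0 < T)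
    (hH : ContDiff ℝ 2 (Function.uncurry H)) {u : ℝ × Eu d → ℝ} (hu : IsC11Solution H G T u) :
    ∃ p : ℝ × Eu d → Eu d,
      (∀ q ∈ strip d T, HasFDerivWithinAt (u ∘ timeRev T)
        (solDiff (Function.uncurry H) (q.2, p q)) (strip d T) q) ∧
      LocallyLipschitzOn (strip d T) p := by
  obtain ⟨⟨hC1, hlip⟩, heq, -⟩ := hu
  have hdiff : ∀ q ∈ strip d T,
      HasFDerivWithinAt u (fderivWithin ℝ u (strip d T) q) (strip d T) q := fun q hq =>
    (hC1.differentiableOn one_ne_zero q hq).hasFDerivWithinAt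
  let R : (ℝ × Eu d →L[ℝ] ℝ) → Eu d := fun D =>
    (InnerProductSpace.toDual ℝ (Eu d)).symm (D.comp (ContinuousLinearMap.inr ℝ ℝ (Eu d)))
  have hR : ContDiff ℝ 1 R := (InnerProductSpace.toDual ℝ (Eu d)).symm.contDiff.comp
    (contDiff_id.clm_comp contDiff_const)
  let P : ℝ × Eu d → Eu d := R ∘ fderivWithin ℝ u (strip d T)
  have hP : LocallyLipschitzOn (strip d T) P :=
    locallyLipschitzOn_comp hR.locallyLipschitz.locallyLipschitzOn hlip (mapsTo_univ _ _)
  -- The equation is assumed only for 0 < t < T. Both sides are continuous on the closed strip, so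
  -- it extends to t = 0 and t = T.
  have hbdry : EqOn (fun q => fderivWithin ℝ u (strip d T) q ((1 : ℝ), (0 : Eu d)))
      (fun q => H q.2 (P q)) (strip d T) := by
    refine EqOn.of_subset_closure (s := Ioo 0 T ×ˢ univ) ?_
      (hlip.continuousOn.clm_apply continuousOn_const)
      (hH.continuous.comp_continuousOn (continuousOn_snd.prodMk hP.continuousOn))
      (prod_mono Ioo_subset_Icc_self subset_rfl) ?_
    · rintro ⟨t, x⟩ ⟨ht, -⟩
      have h1 := (hdiff (t, x) ⟨Ioo_subset_Icc_self ht, mem_univ _⟩).hasFDerivAt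
        (strip_mem_nhds ht x)
      have h2 := heq t ht x
      rw [deriv_time_eq h1, gradient_space_eq h1] at h2
      simp only [P, R, Function.comp_apply]
      linarith
    · rw [closure_prod_eq, closure_Ioo hT.ne, closure_univ]
      exact subset_rfl
  refine ⟨P ∘ timeRev T, fun q hq => ?_,
    locallyLipschitzOn_comp hP locallyLipschitzOn_timeRev mapsTo_timeRev⟩
  refine (hasFDerivWithinAt_comp_timeRev (hdiff _ (mapsTo_timeRev hq))).congr_fderiv ?_
  have h1 := hbdry (mapsTo_timeRev hq)
  simp only at h1
  ext1
  · ext1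
    have h2 : (((-1 : ℝ)), (0 : Eu d)) = (-1 : ℝ) • ((1 : ℝ), (0 : Eu d)) := by simp
    simp only [revCLM, ContinuousLinearMap.comp_apply, ContinuousLinearMap.inl_apply,
      ContinuousLinearMap.prod_apply, neg_apply, ContinuousLinearMap.coe_fst',
      ContinuousLinearMap.coe_snd']
    rw [h2, map_smul, h1]
    simp [solDiff, timeRev]
  · ext1 a
    simp [revCLM, solDiff, P, R]

end Solutions

end HJB

end

theorem mainTheorem1 (d : ℕ) (hd : 1 ≤ d)
    (H : HJB.Eu d → HJB.Eu d → ℝ) (G : HJB.Eu d → ℝ)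
    (hH : ContDiff ℝ 2 (Function.uncurry H)) (hG : ContDiff ℝ 2 G)
    (hH2 : HJB.BoundedSecondDeriv (Function.uncurry H)) (hG2 : HJB.BoundedSecondDeriv G)
    (hconv : ∀ x, ConvexOn ℝ Set.univ (H x))
    (hdisc : HJB.normDpp H * HJB.lambdaH H ≤ HJB.lambdaZero H ^ 2)
    (hterm : 0 ≤ HJB.lambdaZero H
      + Real.sqrt (HJB.lambdaZero H ^ 2 - HJB.normDpp H * HJB.lambdaH H)
      + HJB.normDpp H * HJB.lambdaG G)
    (hsign : HJB.lambdaH H ≤ 0 ∨ 0 ≤ HJB.lambdaZero H) :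
    ∀ T : ℝ, 0 < T → HJB.WellPosedC11 H G T := by
  intro T hT
  obtain ⟨k, k', ε, hb⟩ := HJB.exists_isBarrier hd hH hG hH2 hG2 hconv hdisc hterm hsign T
  obtain ⟨K, hK⟩ := HJB.exists_lipschitzWith_fderiv hH hH2
  obtain ⟨L, hL⟩ := HJB.exists_lipschitzWith_fderiv hG hG2
  have hh : Differentiable ℝ (Function.uncurry H) := hH.differentiable two_ne_zero
  have hg : Differentiable ℝ G := hG.differentiable two_ne_zero
  obtain ⟨Φ, hΦ⟩ := HJB.exists_isFlow (HJB.lipschitzWith_hamField hK) (HJB.contDiff_hamField hH)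
  obtain ⟨c, hc, hexp⟩ := hb.exists_expansion hK (HJB.lipschitzWith_gradient hL) hΦ
  obtain ⟨v, p, hv, hp, hval⟩ := HJB.exists_solution_of_expansion hh hK hg hL hΦ hc hexp
  have hv0 : ∀ x, v (0, x) = G x := fun x => by
    have h1 := hval 0 ⟨le_rfl, hT.le⟩ x
    simpa [HJB.charac, HJB.characValue, hΦ.zero] using h1
  refine ⟨v ∘ HJB.timeRev T, HJB.isC11Solution_comp_timeRev hT hH hv hp hv0, fun w hw q hq => ?_⟩
  -- The competitor, reversed in time, takes the value carried by some characteristic through the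
  -- given point; `hval` says that the constructed solution takes the same value there.
  obtain ⟨p', hw', hp'⟩ := HJB.exists_forward_of_isC11Solution hT hH hw
  have hq' := HJB.mapsTo_timeRev hq
  obtain ⟨y, hy, hwy⟩ := HJB.exists_eq_characValue (g := G) hh hK hΦ hw' hp'
    (fun x => by simp [HJB.timeRev, hw.terminal]) hq'.1 (HJB.timeRev T q).2
  rw [Prod.mk.eta, Function.comp_apply, HJB.timeRev_timeRev] at hwy
  rw [hwy, ← hval _ hq'.1, hy]
  rfl
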